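/- **Setting.** Let $q_e=(q_{ev},q_{e0})\in\mathbb R^3\times\mathbb R$ be a unit quaternion, $\Gamma_e=\tfrac12(q_{e0}I_3+q_{ev}^\times)$, $C_e=(q_{e0}^2-\|q_{ev}\|^2)I_3+2q_{ev}q_{ev}^{T}-2q_{e0}q_{ev}^\times$, $\omega_s=\omega_e+C_e\omega_d$ and $\Omega_e=J\omega_e^\times C_e\omega_d-JC_e\dot\omega_d-\omega_s^\times J\omega_s$. Consider $$\dot q_{ev}=\Gamma_e\omega_e,\qquad \dot q_{e0}=-\tfrac12q_{ev}^{T}\omega_e,\qquad J\dot\omega_e=\Omega_e+u+d,$$ where $J\in\mathbb R^{3\times3}$ is a known symmetric positive definite matrix with extreme eigenvalues $\lambda_{J\min}\le\lambda_{J\max}$, the disturbance satisfies $\|d(t)\|\le D_m$, and $\omega_d$ is a differentiable reference. **Controller.** With $M_\omega>0$, $P_b\in(0,1)$, let $\mathrm{psat}$ be the odd function on $[-1,1]$ with $\mathrm{psat}(x)=K_mx$ for $|x|\le P_b$ and $\mathrm{psat}(x)=a_p(x-1)^2+1$ for $P_b\le x\le1$, where $a_p=1/(P_b^2-1)$ and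 $K_m=(a_p(P_b-1)^2+1)/P_b=2/(1+P_b)$; it acts componentwise on vectors. Let $$\omega_v=-\frac{|q_{e0}|M_\omega}{2\sqrt3}\Gamma_e^{-1}\mathrm{psat}(q_{ev}),\qquad z_2=\omega_e-\omega_v,$$ $$\tau=-\Omega_e-K_\omega z_2-D_m\big(\tanh(z_{2i}/\mu_i)\big)_{i=1}^3+J\dot\omega_v-K_u\xi-\Gamma_eq_{ev}.$$ The actuator output $u$ is the componentwise saturation of a signal $\tau_e$ at level $U_{\max}$, $\Delta\tau=\tau_e-u$, and $$\dot\xi=-\Big[p_1+p_2\|\Delta\tau\|^2/\|\xi\|^2\Big]\xi+K_\tau\tanh(\Delta\tau)$$ (a solution must have $\xi\ne0$ whenever $\Delta\tau\neq0$; the quotient is read as $0$ when $\Delta\tau=0$). **Triggers.** While the actuators are on, since the instant $t_k^{on}$, $\tau_e(t)=\tau(t_k^{on})$; while they are off, $\tau_e=0$. They are turned off at the first instant $t_k^{off}$ at which $\|\tau-\tau(t_k^{on})\|^2$ exceeds $ae^{-\beta t}+b$ or at which the time $T_{\max}$ has passed since $t_k^{on}$, whichever is earlier; they are turned on again at the first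 instant $t_{k+1}^{on}\ge t_k^{off}$ at which $\|z_2\|^2$ exceeds $(\rho_0-\rho_\infty)e^{-\gamma t}+\rho_\infty$. (At an instant at which a threshold is merely attained, switching is allowed but not forced.) At $t=0$ the actuators may be on, or off under the turn-on rule. All parameters $M_\omega,K_\omega,K_u,\mu_i,p_1,p_2,K_\tau,U_{\max},a,b,\beta,T_{\max},\rho_0,\rho_\infty,\gamma$ are positive. Solutions are considered on any interval $[0,H)$, $0<H\le\infty$; no completeness is assumed. **Constants.** Let $b_1>0$, $B_\omega=M_\omega/\sqrt3$, $C_1=K_\omega-\frac{b_1+K_u+1}2$, $C_2=p_1-\frac{K_u+K_\tau}2$, $C_3=p_2-\frac{K_\tau+1}2$, and assume $C_1,C_2,C_3>0$. Let $D_0=0.2785\,D_m\sum_i\mu_i$, $N_k=D_0+\frac b{2b_1}$ and $$V=\tfrac12\|q_{ev}\|^2+\tfrac12z_2^{T}Jz_2+\tfrac12\|\xi\|^2 .$$ A quantity $f$ of the closed loop is *uniformly ultimately bounded (UUB) with bound $R$* over a class of solutions if for every $r$ there is $M$ with $f(t)\le M$ for all $t\ge0$, and for every $r$ and $\varepsilon>0$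 there is $T$ with $f(t)\le R+\varepsilon$ for all $t\ge T$, both for all solutions of the class with $V(0)\le r$ and all $t$ in their interval of existence. **Theorem.** 1. Over the solutions with $q_{e0}(t)\ne0$ for all $t$, $V$ is UUB (with some bound that depends on the parameters only). 2. Let $\delta>0$, $b_2>0$, $C_t=\min(\delta B_\omega,\,2C_1/\lambda_{J\max},\,2C_2)$, $C_d=\min(\delta B_\omega-b_2,\,2C_2)$ with $C_d>0$, and $N_f=\rho_\infty/(2b_2)$. Consider the solutions with $|q_{e0}(t)|\ge\delta$ for all $t$. - If $\lambda_{J\max}/\lambda_{J\min}\le4/\delta^2$ (in particular if $\lambda_{J\max}\le4\lambda_{J\min}$ and $\delta\le 1$), then $V$ is UUB with bound $$\max\Big(\frac{N_k}{C_t},\ \frac{N_f}{C_d}+\frac{\lambda_{J\max}\rho_\infty}2\Big).$$ - For every $J$, $V$ is UUB with bound $$R=\max\Big(\frac{N_k}{C_t},\ \max\Big(\frac{N_f}{C_d},\ \frac{\lambda_{J\max}}{\lambda_{J\min}}\frac{\rho_\infty}{2B_\omega^2}\Big)+\frac{\lambda_{J\max}\rho_\infty}2\Big);$$ consequently $\|q_{ev}\|$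 is UUB with bound $\sqrt{2R}$ and $\|\omega_e\|$ is UUB with bound $\sqrt{2R/\lambda_{J\min}}+K_mB_\omega\sqrt{2R}$. -/

import Mathlib

open Set Matrix

noncomputable section

namespace AttitudeETC

/-- Euclidean three-space. -/
abbrev E3 := EuclideanSpace ℝ (Fin 3)

/-- Matrix times vector, on Euclidean three-space. -/
def mv (A : Matrix (Fin 3) (Fin 3) ℝ) (x : E3) : E3 := WithLp.toLp 2 (A *ᵥ x.ofLp)

/-- Apply a function componentwise. -/
def vmap (f : ℝ → ℝ) (x : E3) : E3 := WithLp.toLp 2 (fun i => f (x i))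

/-- The cross-product matrix: `mv (skew a) b` is `a × b`. -/
def skew (a : E3) : Matrix (Fin 3) (Fin 3) ℝ :=
  !![0, -a 2, a 1; a 2, 0, -a 0; -a 1, a 0, 0]

/-- Physical constants and design parameters. -/
structure Params where
  /-- inertia matrix -/
  J : Matrix (Fin 3) (Fin 3) ℝ
  J_posDef : J.PosDef
  /-- known bound of the disturbance -/
  Dm : ℝ
  Dm_nonneg : 0 ≤ Dm
  /-- actuator saturation level -/
  Umax : ℝ
  Umax_pos : 0 < Umax
  /-- parameters of the virtual law -/
  Mω : ℝ
  Mω_pos : 0 < Mω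
  Pb : ℝ
  Pb_pos : 0 < Pb
  Pb_lt_one : Pb < 1
  /-- gains of the actual law and of the auxiliary system -/
  Kω : ℝ
  Kω_pos : 0 < Kω
  Ku : ℝ
  Ku_pos : 0 < Ku
  μ : Fin 3 → ℝ
  μ_pos : ∀ i, 0 < μ i
  p₁ : ℝ
  p₁_pos : 0 < p₁
  p₂ : ℝ
  p₂_pos : 0 < p₂
  Kτ : ℝ
  Kτ_pos : 0 < Kτ
  /-- parameters of the turn-off trigger -/
  a : ℝ
  a_pos : 0 < a
  b : ℝ
  b_pos : 0 < b
  β : ℝ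
  β_pos : 0 < β
  Tmax : ℝ
  Tmax_pos : 0 < Tmax
  /-- parameters of the turn-on trigger -/
  ρ₀ : ℝ
  ρ₀_pos : 0 < ρ₀
  ρinf : ℝ
  ρinf_pos : 0 < ρinf
  γ : ℝ
  γ_pos : 0 < γ

namespace Params

variable (P : Params)

/-- Largest eigenvalue of the inertia matrix. -/
def lamMax : ℝ := ⨆ i, P.J_posDef.isHermitian.eigenvalues i

/-- Smallest eigenvalue of the inertia matrix. -/
def lamMin : ℝ := ⨅ i, P.J_posDef.isHermitian.eigenvalues i

/-- Quadratic coefficient of `psat`. -/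
def ap : ℝ := 1 / (P.Pb ^ 2 - 1)

/-- Slope of the linear piece of `psat`: the value for which `psat` is continuous
(it is then continuously differentiable, and the slope is `2 / (1 + Pb)`). -/
def Km : ℝ := (P.ap * (P.Pb - 1) ^ 2 + 1) / P.Pb

/-- The piecewise saturation function (used on `[-1, 1]` only). -/
def psat (x : ℝ) : ℝ :=
  if x < -P.Pb then -P.ap * (x + 1) ^ 2 - 1
  else if x ≤ P.Pb then P.Km * x
  else P.ap * (x - 1) ^ 2 + 1

/-- Input saturation of one actuator axis. -/
def sat (x : ℝ) : ℝ := if |x| ≤ P.Umax then x else P.Umax * Real.sign x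

/-- Turn-off threshold. -/
def offThreshold (t : ℝ) : ℝ := P.a * Real.exp (-P.β * t) + P.b

/-- Turn-on threshold. -/
def onThreshold (t : ℝ) : ℝ := (P.ρ₀ - P.ρinf) * Real.exp (-P.γ * t) + P.ρinf

end Params

/-- The signals of the closed loop. Switching instants are extended reals: an instant that is
not smaller than the horizon of the solution stands for an event that does not occur. -/
structure Signals where
  /-- vector part of the attitude error quaternion -/
  qv : ℝ → E3
  /-- scalar part of the attitude error quaternion -/
  q₀ : ℝ → ℝ
  /-- error angular velocity -/
  ωe : ℝ → E3
  /-- state of the saturation-compensation system -/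
  ξ : ℝ → E3
  /-- desired angular velocity -/
  ωd : ℝ → E3
  /-- derivative of the desired angular velocity -/
  dωd : ℝ → E3
  /-- derivative of the virtual law along the trajectory -/
  dωv : ℝ → E3
  /-- disturbance -/
  d : ℝ → E3
  /-- sample-and-hold control signal -/
  τe : ℝ → E3
  /-- turn-on instants -/
  ton : ℕ → EReal
  /-- turn-off instants -/
  toff : ℕ → EReal

namespace Signals

variable (P : Params) (X : Signals)

/-- Jacobian of the error kinematics. -/
def Γ (t : ℝ) : Matrix (Fin 3) (Fin 3) ℝ :=
  (1 / 2 : ℝ) • (X.q₀ t • (1 : Matrix (Fin 3) (Fin 3) ℝ) + skew (X.qv t))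

/-- Rotation matrix from the target frame to the body frame. -/
def Ce (t : ℝ) : Matrix (Fin 3) (Fin 3) ℝ :=
  (X.q₀ t ^ 2 - ‖X.qv t‖ ^ 2) • (1 : Matrix (Fin 3) (Fin 3) ℝ)
    + (2 : ℝ) • Matrix.vecMulVec (X.qv t).ofLp (X.qv t).ofLp
    - (2 * X.q₀ t) • skew (X.qv t)

/-- Angular velocity of the spacecraft in the body frame. -/
def ωs (t : ℝ) : E3 := X.ωe t + mv (X.Ce t) (X.ωd t)

/-- Lumped dynamical term. -/
def Ωe (t : ℝ) : E3 :=
  mv P.J (mv (skew (X.ωe t)) (mv (X.Ce t) (X.ωd t)))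
    - mv P.J (mv (X.Ce t) (X.dωd t))
    - mv (skew (X.ωs t)) (mv P.J (X.ωs t))

/-- Virtual control law. -/
def ωv (t : ℝ) : E3 :=
  -(|X.q₀ t| * P.Mω / (2 * √3)) • mv (X.Γ t)⁻¹ (vmap P.psat (X.qv t))

/-- Tracking error of the dynamical layer. -/
def z₂ (t : ℝ) : E3 := X.ωe t - X.ωv P t

/-- Disturbance compensation. -/
def dhat (t : ℝ) : E3 :=
  P.Dm • WithLp.toLp 2 (fun i => Real.tanh (X.z₂ P t i / P.μ i))

/-- The computed control law. -/
def τ (t : ℝ) : E3 :=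
  -X.Ωe P t - P.Kω • X.z₂ P t - X.dhat P t + mv P.J (X.dωv t) - P.Ku • X.ξ t
    - mv (X.Γ t) (X.qv t)

/-- Actuator output. -/
def u (t : ℝ) : E3 := vmap P.sat (X.τe t)

/-- Saturation variable. -/
def Δτ (t : ℝ) : E3 := X.τe t - X.u P t

/-- Deviation of the computed law from its value at the `k`-th turn-on instant, that is, the
error `e_τ = τ - τ_e` while the actuators are on. -/
def eτ (k : ℕ) (t : ℝ) : E3 := X.τ P t - X.τ P (X.ton k).toReal

/-- The lumped Lyapunov function. -/
def V (t : ℝ) : ℝ :=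
  ‖X.qv t‖ ^ 2 / 2 + inner ℝ (X.z₂ P t) (mv P.J (X.z₂ P t)) / 2 + ‖X.ξ t‖ ^ 2 / 2

/-- The actuators are switched off at `s` and next switched on at `s'`: they stay off as long as
the turn-on threshold is not exceeded, and `s'` (if it lies before the horizon `H`) is an instant
at which `‖z₂‖²` reaches or exceeds the threshold; `s' = s` if it does so at once. -/
structure TurnOn (H s s' : EReal) : Prop where
  le : s ≤ s'
  before : ∀ t : ℝ, s < t → (t : EReal) < s' → (t : EReal) < H →
    ‖X.z₂ P t‖ ^ 2 ≤ P.onThreshold t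
  reach : s' < H → P.onThreshold s'.toReal ≤ ‖X.z₂ P s'.toReal‖ ^ 2

/-- The actuators are switched on at `ton k` and next switched off at `toff k`: they stay on as
long as `‖e_τ‖²` does not exceed the turn-off threshold, at most for the time `Tmax`, and are
switched off (if this happens before the horizon `H`) when `‖e_τ‖²` reaches the threshold or
the time `Tmax` has passed. -/
structure TurnOff (H : EReal) (k : ℕ) : Prop where
  le : X.ton k ≤ X.toff k
  le_max : X.toff k ≤ X.ton k + (P.Tmax : EReal)
  before : ∀ t : ℝ, X.ton k < t → (t : EReal) < X.toff k → (t : EReal) < H →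
    ‖X.eτ P k t‖ ^ 2 ≤ P.offThreshold t
  reach : X.toff k < H → X.toff k = X.ton k + (P.Tmax : EReal) ∨
    P.offThreshold (X.toff k).toReal ≤ ‖X.eτ P k (X.toff k).toReal‖ ^ 2

/-- The actuators are on at time `t`, having been switched on for the `k`-th time. -/
def OnPhase (k : ℕ) (t : ℝ) : Prop := X.ton k ≤ t ∧ (t : EReal) < X.toff k

/-- The actuators are off at time `t` (before the first turn-on, or after some turn-off). -/
def OffPhase (t : ℝ) : Prop :=
  (t : EReal) < X.ton 0 ∨ ∃ k, X.toff k ≤ t ∧ (t : EReal) < X.ton (k + 1)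

/-- `X` is a solution of the closed loop on `[0, H)`, where `0 < H ≤ ∞`. The differential equations
hold with right derivatives, because the right-hand side jumps at switching instants. -/
structure IsSolution (H : EReal) : Prop where
  horizon_pos : 0 < H
  -- regularity of the state and of the reference
  cont_qv : ContinuousOn X.qv {t : ℝ | 0 ≤ t ∧ (t : EReal) < H}
  cont_q₀ : ContinuousOn X.q₀ {t : ℝ | 0 ≤ t ∧ (t : EReal) < H}
  cont_ωe : ContinuousOn X.ωe {t : ℝ | 0 ≤ t ∧ (t : EReal) < H}
  cont_ξ : ContinuousOn X.ξ {t : ℝ | 0 ≤ t ∧ (t : EReal) < H}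
  deriv_ωd : ∀ t : ℝ, 0 ≤ t → (t : EReal) < H → HasDerivWithinAt X.ωd (X.dωd t) (Ici t) t
  deriv_ωv : ∀ t : ℝ, 0 ≤ t → (t : EReal) < H → HasDerivWithinAt (X.ωv P) (X.dωv t) (Ici t) t
  -- unit quaternion, bounded disturbance
  unit : ∀ t : ℝ, 0 ≤ t → (t : EReal) < H → ‖X.qv t‖ ^ 2 + X.q₀ t ^ 2 = 1
  dist : ∀ t : ℝ, 0 ≤ t → (t : EReal) < H → ‖X.d t‖ ≤ P.Dm
  -- kinematics and dynamics
  kin_v : ∀ t : ℝ, 0 ≤ t → (t : EReal) < H →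
    HasDerivWithinAt X.qv (mv (X.Γ t) (X.ωe t)) (Ici t) t
  kin_0 : ∀ t : ℝ, 0 ≤ t → (t : EReal) < H →
    HasDerivWithinAt X.q₀ (-(1 / 2) * inner ℝ (X.qv t) (X.ωe t)) (Ici t) t
  dyn : ∀ t : ℝ, 0 ≤ t → (t : EReal) < H →
    HasDerivWithinAt (fun s => mv P.J (X.ωe s)) (X.Ωe P t + X.u P t + X.d t) (Ici t) t
  -- compensation system; its quotient has to be defined wherever its numerator is not zero
  comp_dom : ∀ t : ℝ, 0 ≤ t → (t : EReal) < H → X.Δτ P t ≠ 0 → X.ξ t ≠ 0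
  comp : ∀ t : ℝ, 0 ≤ t → (t : EReal) < H →
    HasDerivWithinAt X.ξ
      (-(P.p₁ + P.p₂ * ‖X.Δτ P t‖ ^ 2 / ‖X.ξ t‖ ^ 2) • X.ξ t
        + P.Kτ • vmap Real.tanh (X.Δτ P t)) (Ici t) t
  -- switching: the actuators are on or off at the start, then the two triggers alternate
  start : X.ton 0 = 0 ∨ X.TurnOn P H 0 (X.ton 0)
  turnOff : ∀ k, X.TurnOff P H k
  turnOn : ∀ k, X.TurnOn P H (X.toff k) (X.ton (k + 1))
  cover : ∀ t : ℝ, 0 ≤ t → (t : EReal) < H → (∃ k, X.OnPhase k t) ∨ X.OffPhase t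
  -- sample-and-hold signal
  hold : ∀ k, ∀ t : ℝ, (t : EReal) < H → X.OnPhase k t → X.τe t = X.τ P (X.ton k).toReal
  off : ∀ t : ℝ, 0 ≤ t → (t : EReal) < H → X.OffPhase t → X.τe t = 0

end Signals

/-- Uniform ultimate boundedness, with ultimate bound `R`, of a quantity `f` of the closed loop with
parameters `P`, over all solutions whose `q₀` satisfies `c` at all times: `f` is bounded, and after
some time it is at most `R + ε`; the bound and the time depend on the solution only through a
bound `r` of the initial value of the Lyapunov function. -/
def UUB (P : Params) (c : ℝ → Prop) (f : Signals → ℝ → ℝ) (R : ℝ) : Prop :=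
  ∀ r : ℝ,
    (∃ M : ℝ, ∀ (X : Signals) (H : EReal), X.IsSolution P H →
      (∀ t : ℝ, 0 ≤ t → (t : EReal) < H → c (X.q₀ t)) → X.V P 0 ≤ r →
      ∀ t : ℝ, 0 ≤ t → (t : EReal) < H → f X t ≤ M) ∧
    ∀ ε : ℝ, 0 < ε → ∃ T : ℝ, 0 ≤ T ∧ ∀ (X : Signals) (H : EReal), X.IsSolution P H →
      (∀ t : ℝ, 0 ≤ t → (t : EReal) < H → c (X.q₀ t)) → X.V P 0 ≤ r →
      ∀ t : ℝ, T ≤ t → (t : EReal) < H → f X t ≤ R + ε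

namespace Params

variable (P : Params)

def Bω : ℝ := P.Mω / √3

def C₁ (b₁ : ℝ) : ℝ := P.Kω - (b₁ + P.Ku + 1) / 2

def C₂ : ℝ := P.p₁ - (P.Ku + P.Kτ) / 2

def C₃ : ℝ := P.p₂ - (P.Kτ + 1) / 2

def D₀ : ℝ := 0.2785 * P.Dm * ∑ i, P.μ i

/-- Decay rate while the actuators are on, when `|q₀| ≥ δ`. -/
def Ct (δ b₁ : ℝ) : ℝ := min (δ * P.Bω) (min (2 * P.C₁ b₁ / P.lamMax) (2 * P.C₂))

/-- Decay rate while the actuators are off, when `|q₀| ≥ δ`. -/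
def Cd (δ b₂ : ℝ) : ℝ := min (δ * P.Bω - b₂) (2 * P.C₂)

def Nk (b₁ : ℝ) : ℝ := P.D₀ + P.b / (2 * b₁)

def Nf (b₂ : ℝ) : ℝ := P.ρinf / (2 * b₂)

/-- The residual level for a moderately conditioned inertia matrix. -/
def residual (δ b₁ b₂ : ℝ) : ℝ :=
  max (P.Nk b₁ / P.Ct δ b₁) (P.Nf b₂ / P.Cd δ b₂ + P.lamMax * P.ρinf / 2)

/-- The residual level for an arbitrary inertia matrix. -/
def residualGen (δ b₁ b₂ : ℝ) : ℝ :=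
  max (P.Nk b₁ / P.Ct δ b₁)
    (max (P.Nf b₂ / P.Cd δ b₂) (P.lamMax / P.lamMin * P.ρinf / (2 * P.Bω ^ 2))
      + P.lamMax * P.ρinf / 2)

end Params

end AttitudeETC

end

noncomputable section

namespace AttitudeETC

open Filter Topology

/-! The obstacle is the off phase: `z₂` is then uncontrolled and `V` need not decrease. It is,
however, kept small by the turn-on trigger, `‖z₂‖² ≤ onThreshold`. So at every instant either `V`
dissipates, with the hold error bounded by `offThreshold`, or the `z₂` part of `V` is small
(`dissipation_or_small`). This alternative is pointwise in time. Together with continuity of `V` and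
the barrier lemma `le_max_of_eventually_decreasing`, it makes any counting of switching instants
unnecessary.

If only `q₀ ≠ 0` is known, the decay of `qv` may degenerate, but `‖qv‖ ≤ 1` bounds its share of `V`
by `1/2`. The energy of `ξ` decays in both phases, because the quotient in its equation produces
`-p₂‖Δτ‖²` and absorbs the saturation error. Above a large enough level the off phase is therefore
impossible, and `V` decreases (`V_le_max`).

If `|q₀| ≥ δ`, the comparison function is `max V (V₁ + L)`, with `V₁` the part of `V` without `z₂`
and `L` slightly above `lamMax * ρinf / 2` (`eventually_max_V_le`). Where `V` is the larger entry,
`z₂` exceeds the turn-on threshold, so the actuators are on and `V` dissipates. Where `V₁ + L` is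
the larger, `‖z₂‖²` is at most about `lamMax / lamMin * ρinf`. Once `ξ` has died out, a large `V₁`
means a large `qv`, for which `Bω‖qv‖` dominates `‖z₂‖`, and `V₁` decreases in either phase. The
resulting `level` does not involve `b₂`; both residuals of the theorem dominate it, the first under
the condition on the eigenvalues of `J`. -/

/-! ### A barrier lemma -/

/-- A function that decreases at rate at least `c` to the right of every point where it exceeds
`K` stays below the maximum of `K` and a line of slope `-c`. -/
theorem le_max_of_eventually_decreasing {f : ℝ → ℝ} {a b c K : ℝ} (hab : a ≤ b) (hc : 0 ≤ c)
    (hf : ContinuousOn f (Icc a b))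
    (h : ∀ t ∈ Ico a b, K < f t → ∀ᶠ s in 𝓝[>] t, f s ≤ f t - c * (s - t)) :
    f b ≤ max (f a - c * (b - a)) K := by
  -- The slack `ε` serves the continuous induction at points with `f t ≤ K`: there no decrease is
  -- assumed, but continuity keeps `f` below `K + ε` for a while.
  refine le_of_forall_pos_le_add fun ε hε => ?_
  have key : Icc a b ⊆ {t | f t ≤ max (f a - c * (t - a)) (K + ε)} := by
    refine IsClosed.Icc_subset_of_forall_mem_nhdsWithin ?_ (by simp) ?_
    · have : {t | f t ≤ max (f a - c * (t - a)) (K + ε)} ∩ Icc a b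
          = {t ∈ Icc a b | f t ≤ max (f a - c * (t - a)) (K + ε)} := by
        ext t; simp [and_comm]
      rw [this]
      exact isClosed_Icc.isClosed_le hf (by fun_prop)
    · rintro t ⟨ht, hts⟩
      simp only [mem_ofPred_eq] at ht
      by_cases hK : K < f t
      · filter_upwards [h t hts hK, self_mem_nhdsWithin] with s hs hst
        have hst' : 0 ≤ c * (s - t) := mul_nonneg hc (sub_nonneg.2 (le_of_lt hst))
        simp only [le_max_iff] at ht ⊢
        rcases ht with ht | ht
        · left; linarith
        · right; linarith
      · have hcont : Tendsto f (𝓝[>] t) (𝓝 (f t)) :=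
          (hf t ⟨hts.1, hts.2.le⟩).mono_of_mem_nhdsWithin
            (mem_of_superset (Ioo_mem_nhdsGT hts.2) fun s hs => ⟨hts.1.trans hs.1.le, hs.2.le⟩)
        filter_upwards [hcont.eventually (gt_mem_nhds (show f t < K + ε by linarith))] with s hs
        exact le_max_of_le_right hs.le
  have hb : f b ≤ max (f a - c * (b - a)) (K + ε) := key ⟨hab, le_rfl⟩
  refine hb.trans (max_le ?_ ?_)
  · linarith [le_max_left (f a - c * (b - a)) K]
  · linarith [le_max_right (f a - c * (b - a)) K]

theorem eventually_le_of_hasDerivWithinAt_lt {f : ℝ → ℝ} {f' c t : ℝ}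
    (hf : HasDerivWithinAt f f' (Ici t) t) (hc : f' < -c) :
    ∀ᶠ s in 𝓝[>] t, f s ≤ f t - c * (s - t) := by
  have h := (hasDerivWithinAt_iff_tendsto_slope' (lt_irrefl t)).1 hf.Ioi_of_Ici
  filter_upwards [h.eventually (gt_mem_nhds hc), self_mem_nhdsWithin] with s hs hst
  have hst' : 0 < s - t := sub_pos.2 hst
  rw [slope_def_field, div_lt_iff₀ hst'] at hs
  linarith

/-- Only an entry that attains the maximum has to decrease: a strictly smaller one stays below the
descending line for a short time by continuity. -/
theorem eventually_max_le {f g : ℝ → ℝ} {c t : ℝ}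
    (hf : ContinuousWithinAt f (Ici t) t) (hg : ContinuousWithinAt g (Ici t) t)
    (hfd : g t ≤ f t → ∀ᶠ s in 𝓝[>] t, f s ≤ f t - c * (s - t))
    (hgd : f t ≤ g t → ∀ᶠ s in 𝓝[>] t, g s ≤ g t - c * (s - t)) :
    ∀ᶠ s in 𝓝[>] t, max (f s) (g s) ≤ max (f t) (g t) - c * (s - t) := by
  have aux : ∀ {f g : ℝ → ℝ}, ContinuousWithinAt f (Ici t) t →
      (g t ≤ f t → ∀ᶠ s in 𝓝[>] t, f s ≤ f t - c * (s - t)) →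
      ∀ᶠ s in 𝓝[>] t, f s ≤ max (f t) (g t) - c * (s - t) := by
    intro f g hf hfd
    rcases le_or_gt (g t) (f t) with h | h
    · simpa [h] using hfd h
    · have h1 : Tendsto (fun s => f s + c * (s - t)) (𝓝[>] t) (𝓝 (f t + c * (t - t))) :=
        Tendsto.add (hf.mono Ioi_subset_Ici_self)
          (Continuous.tendsto' (by fun_prop) _ _ rfl |>.mono_left nhdsWithin_le_nhds)
      filter_upwards [h1.eventually (gt_mem_nhds (show f t + c * (t - t) < g t by simpa))] with s hs
      rw [max_eq_right h.le]
      linarith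
  filter_upwards [aux hf hfd, aux hg hgd] with s h1 h2
  exact max_le h1 (by rwa [max_comm])

theorem mv_eq (A : Matrix (Fin 3) (Fin 3) ℝ) (x : E3) :
    mv A x = toEuclideanCLM (𝕜 := ℝ) A x := rfl

/-! ### Scalar inequalities -/

theorem inv_le_exp : (1 : ℝ) / 0.2785 ≤ Real.exp 1.2785 := by
  have h := Real.sum_le_exp_of_nonneg (x := 1.2785) (by norm_num) 10
  refine le_trans ?_ h
  norm_num [Finset.sum_range_succ, Nat.factorial]

/-- Tangent line of `exp` at `1.2785`. The optimal constant `κ` solves `κ = exp (-(κ + 1))`, and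
`0.2785` is this root rounded up, which is the content of `inv_le_exp`. -/
theorem le_mul_exp_add_one (y : ℝ) : y ≤ 0.2785 * (Real.exp y + 1) := by
  have h1 : y - 1.2785 + 1 ≤ Real.exp (y - 1.2785) := Real.add_one_le_exp _
  have h2 : Real.exp y = Real.exp (y - 1.2785) * Real.exp 1.2785 := by
    rw [← Real.exp_add]; ring_nf
  have h3 := mul_le_mul_of_nonneg_left inv_le_exp (Real.exp_pos (y - 1.2785)).le
  rw [← h2] at h3
  linarith

theorem one_sub_tanh (x : ℝ) : 1 - Real.tanh x = 2 / (Real.exp (2 * x) + 1) := by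
  have h : Real.exp (2 * x) * Real.exp (-x) = Real.exp x := by rw [← Real.exp_add]; ring_nf
  have h1 := Real.exp_pos x
  have h2 := Real.exp_pos (-x)
  have h3 := Real.exp_pos (2 * x)
  rw [Real.tanh_eq]
  rw [← h]
  field_simp
  ring

theorem mul_one_sub_tanh_le (x : ℝ) : x * (1 - Real.tanh x) ≤ 0.2785 := by
  have h := le_mul_exp_add_one (2 * x)
  have h3 := Real.exp_pos (2 * x)
  rw [one_sub_tanh, mul_div_assoc', div_le_iff₀ (by linarith)]
  linarith

theorem abs_sub_mul_tanh_div_le {μ : ℝ} (hμ : 0 < μ) (x : ℝ) :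
    |x| - x * Real.tanh (x / μ) ≤ 0.2785 * μ := by
  have key : ∀ y : ℝ, y - y * Real.tanh (y / μ) ≤ 0.2785 * μ := by
    intro y
    have := mul_le_mul_of_nonneg_left (mul_one_sub_tanh_le (y / μ)) hμ.le
    have e : μ * (y / μ * (1 - Real.tanh (y / μ))) = y - y * Real.tanh (y / μ) := by
      field_simp
    linarith
  rcases abs_cases x with ⟨h, _⟩ | ⟨h, _⟩
  · rw [h]; exact key x
  · have := key (-x)
    rw [neg_div, Real.tanh_neg] at this
    rw [h]; linarith

theorem sq_tanh_le (x : ℝ) : Real.tanh x ^ 2 ≤ x ^ 2 := by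
  have key : ∀ y : ℝ, 0 ≤ y → 0 ≤ Real.tanh y ∧ Real.tanh y ≤ y := by
    intro y hy
    have e := one_sub_tanh y
    have h1 := Real.add_one_le_exp (2 * y)
    constructor
    · have : 2 / (Real.exp (2 * y) + 1) ≤ 1 := by rw [div_le_one (by linarith)]; linarith
      linarith
    -- For `y ≥ 1` this is `sinh < cosh`; on `[0, 1]` the difference vanishes at `0` and has
    -- derivative `y * sinh y ≥ 0`.
    · have hs : Real.sinh y ≤ y * Real.cosh y := by
        rcases hy.eq_or_lt with rfl | hy'
        · simp
        rcases le_or_gt 1 y with h | h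
        · nlinarith [Real.sinh_lt_cosh y, Real.cosh_pos y]
        · have mono : MonotoneOn (fun y => y * Real.cosh y - Real.sinh y) (Icc 0 1) := by
            refine monotoneOn_of_deriv_nonneg (convex_Icc 0 1) (by fun_prop) (by fun_prop) ?_
            intro x hx
            rw [interior_Icc] at hx
            have : HasDerivAt (fun y => y * Real.cosh y - Real.sinh y)
                (1 * Real.cosh x + x * Real.sinh x - Real.cosh x) x :=
              ((hasDerivAt_id' x).mul (Real.hasDerivAt_cosh x)).sub (Real.hasDerivAt_sinh x)
            rw [this.deriv]
            nlinarith [Real.sinh_nonneg_iff.2 hx.1.le, hx.1]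
          have := mono (a := 0) (by simp) ⟨hy, h.le⟩ hy
          simp at this
          linarith
      rw [Real.tanh_eq_sinh_div_cosh, div_le_iff₀ (Real.cosh_pos y)]
      exact hs
  rcases le_total 0 x with h | h
  · have := key x h; nlinarith
  · have := key (-x) (by linarith)
    rw [Real.tanh_neg] at this; nlinarith

/-! ### The saturation function `psat`, and eigenvalues of the inertia matrix -/

namespace Params

variable (P : Params)

theorem one_sub_Pb_sq_pos : 0 < 1 - P.Pb ^ 2 := by nlinarith [P.Pb_pos, P.Pb_lt_one]

theorem ap_eq : P.ap = -(1 / (1 - P.Pb ^ 2)) := by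
  have := P.one_sub_Pb_sq_pos
  rw [ap, ← neg_sub, div_neg]

theorem Km_eq : P.Km = 2 / (1 + P.Pb) := by
  have h1 := P.one_sub_Pb_sq_pos
  have h2 := P.Pb_pos
  rw [Km, ap_eq]
  field_simp
  ring

theorem one_le_Km : 1 ≤ P.Km := by
  rw [Km_eq, le_div_iff₀ (by linarith [P.Pb_pos])]
  linarith [P.Pb_lt_one]

theorem psat_neg (x : ℝ) : P.psat (-x) = -P.psat x := by
  have h2 := P.Pb_pos
  have h1 := P.one_sub_Pb_sq_pos
  unfold psat
  split_ifs <;> first | (exfalso; linarith) | ring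

/-- On `[0, 1]` the graph lies between the chord through `(0, 0)` and `(1, 1)` and the tangent at
`Pb`. On the quadratic piece the lower bound reduces to `Pb² ≤ x`, the upper one to `(x - Pb)² ≥ 0`.
-/
theorem psat_bounds {x : ℝ} (h0 : 0 ≤ x) (h1 : x ≤ 1) :
    x ≤ P.psat x ∧ P.psat x ≤ P.Km * x := by
  have hP := P.Pb_pos
  have hP1 := P.Pb_lt_one
  have hd := P.one_sub_Pb_sq_pos
  have hK := P.one_le_Km
  unfold psat
  rw [if_neg (by linarith)]
  split_ifs with h
  · exact ⟨by nlinarith, le_rfl⟩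
  · rw [not_le] at h
    have e : P.ap * (x - 1) ^ 2 + 1 = 1 - (1 - x) ^ 2 / (1 - P.Pb ^ 2) := by
      rw [ap_eq]; ring
    rw [e]
    constructor
    · have : (1 - x) ^ 2 / (1 - P.Pb ^ 2) ≤ 1 - x := by
        rw [div_le_iff₀ hd]
        nlinarith [mul_nonneg (sub_nonneg.2 h1) (show 0 ≤ x - P.Pb ^ 2 by nlinarith)]
      linarith
    · have : P.Km * x = 2 * x * (1 - P.Pb) / (1 - P.Pb ^ 2) := by
        rw [Km_eq, show 1 - P.Pb ^ 2 = (1 + P.Pb) * (1 - P.Pb) by ring]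
        have : 1 - P.Pb ≠ 0 := by linarith
        field_simp
      rw [this, sub_le_iff_le_add, ← add_div, le_div_iff₀ hd]
      nlinarith [sq_nonneg (x - P.Pb)]

theorem sq_le_mul_psat {x : ℝ} (h : |x| ≤ 1) : x ^ 2 ≤ x * P.psat x := by
  rcases le_total 0 x with h0 | h0
  · rw [abs_of_nonneg h0] at h
    have := P.psat_bounds h0 h
    nlinarith
  · rw [abs_of_nonpos h0] at h
    have := P.psat_bounds (neg_nonneg.2 h0) h
    rw [psat_neg] at this
    nlinarith

theorem sq_psat_le {x : ℝ} (h : |x| ≤ 1) : P.psat x ^ 2 ≤ P.Km ^ 2 * x ^ 2 := by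
  rw [← mul_pow]
  rcases le_total 0 x with h0 | h0
  · rw [abs_of_nonneg h0] at h
    have := P.psat_bounds h0 h
    exact pow_le_pow_left₀ (h0.trans this.1) this.2 2
  · rw [abs_of_nonpos h0] at h
    have := P.psat_bounds (neg_nonneg.2 h0) h
    rw [psat_neg] at this
    nlinarith

theorem continuous_psat : Continuous P.psat := by
  have hP := P.Pb_pos
  have hd := P.one_sub_Pb_sq_pos
  have e : P.Km * P.Pb = P.ap * (P.Pb - 1) ^ 2 + 1 := by rw [Km]; field_simp
  have e1 : P.psat = fun x => if x ≤ P.Pb then (if -P.Pb ≤ x then P.Km * x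
      else -P.ap * (x + 1) ^ 2 - 1) else P.ap * (x - 1) ^ 2 + 1 := by
    funext x
    unfold psat
    split_ifs <;> first | rfl | (exfalso; linarith)
  rw [e1]
  refine Continuous.if_le (Continuous.if_le (by fun_prop) (by fun_prop) continuous_const
    continuous_id ?_) (by fun_prop) continuous_id continuous_const ?_
  · rintro x rfl; linarith
  · rintro x rfl
    rw [if_pos (by linarith)]; exact e

theorem Bω_pos : 0 < P.Bω := div_pos P.Mω_pos (by positivity)

theorem offThreshold_pos (t : ℝ) : 0 < P.offThreshold t := by
  have := P.a_pos; have := P.b_pos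
  unfold offThreshold; positivity

/-! ### Eigenvalue bounds of the inertia matrix -/

theorem inner_mv_J_eq_sum (z : E3) :
    inner ℝ z (mv P.J z) = ∑ i, P.J_posDef.isHermitian.eigenvalues i *
      inner ℝ (P.J_posDef.isHermitian.eigenvectorBasis i) z ^ 2 := by
  set B := P.J_posDef.isHermitian.eigenvectorBasis
  have hJ : ∀ i, mv P.J (B i) = P.J_posDef.isHermitian.eigenvalues i • B i := by
    intro i
    have := P.J_posDef.isHermitian.mulVec_eigenvectorBasis i
    apply (WithLp.ofLp_injective 2)
    simpa [mv] using this
  have hlin : mv P.J z = ∑ i, inner ℝ (B i) z • mv P.J (B i) := by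
    conv_lhs => rw [← B.sum_repr' z]
    simp only [mv_eq, map_sum, map_smul]
  rw [hlin, inner_sum]
  refine Finset.sum_congr rfl fun i _ => ?_
  rw [hJ, inner_smul_right, inner_smul_right, real_inner_comm]
  ring

theorem inner_mv_J_le (z : E3) : inner ℝ z (mv P.J z) ≤ P.lamMax * ‖z‖ ^ 2 := by
  rw [inner_mv_J_eq_sum, ← P.J_posDef.isHermitian.eigenvectorBasis.sum_sq_inner_right z,
    Finset.mul_sum]
  exact Finset.sum_le_sum fun i _ => mul_le_mul_of_nonneg_right
    (le_ciSup (Set.finite_range _).bddAbove i) (sq_nonneg _)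

theorem le_inner_mv_J (z : E3) : P.lamMin * ‖z‖ ^ 2 ≤ inner ℝ z (mv P.J z) := by
  rw [inner_mv_J_eq_sum, ← P.J_posDef.isHermitian.eigenvectorBasis.sum_sq_inner_right z,
    Finset.mul_sum]
  exact Finset.sum_le_sum fun i _ => mul_le_mul_of_nonneg_right
    (ciInf_le (Set.finite_range _).bddBelow i) (sq_nonneg _)

theorem lamMin_pos : 0 < P.lamMin := by
  obtain ⟨i, hi⟩ := exists_eq_ciInf_of_finite (f := P.J_posDef.isHermitian.eigenvalues)
  rw [lamMin, ← hi]
  exact P.J_posDef.eigenvalues_pos i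

theorem lamMin_le_lamMax : P.lamMin ≤ P.lamMax :=
  (ciInf_le (Set.finite_range _).bddBelow 0).trans
    (le_ciSup (f := P.J_posDef.isHermitian.eigenvalues) (Set.finite_range _).bddAbove 0)

theorem lamMax_pos : 0 < P.lamMax := P.lamMin_pos.trans_le P.lamMin_le_lamMax

end Params

/-! ### Linear algebra in three-space -/

theorem inner_eq (x y : E3) : inner ℝ x y = x 0 * y 0 + x 1 * y 1 + x 2 * y 2 := by
  simp [PiLp.inner_apply, Fin.sum_univ_three]
  ring

theorem norm_sq_eq (x : E3) : ‖x‖ ^ 2 = x 0 ^ 2 + x 1 ^ 2 + x 2 ^ 2 := by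
  rw [← real_inner_self_eq_norm_sq, inner_eq]; ring

theorem inner_mv_J_comm (P : Params) (x y : E3) :
    inner ℝ x (mv P.J y) = inner ℝ y (mv P.J x) := by
  have h : ∀ i j, P.J i j = P.J j i := fun i j => by
    simpa using (congrFun (congrFun P.J_posDef.isHermitian j) i)
  simp only [inner_eq, mv, mulVec, dotProduct, Fin.sum_univ_three]
  rw [h 1 0, h 2 0, h 2 1]
  ring

theorem vmap_apply (f : ℝ → ℝ) (x : E3) (i : Fin 3) : vmap f x i = f (x i) := rfl

theorem sq_norm_le_inner_vmap_psat (P : Params) {q : E3} (hq : ‖q‖ ≤ 1) :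
    ‖q‖ ^ 2 ≤ inner ℝ q (vmap P.psat q) := by
  have h : ∀ i, |q i| ≤ 1 := fun i => (PiLp.norm_apply_le q i).trans hq
  rw [norm_sq_eq, inner_eq]
  simp only [vmap_apply]
  linarith [P.sq_le_mul_psat (h 0), P.sq_le_mul_psat (h 1), P.sq_le_mul_psat (h 2)]

theorem norm_vmap_psat_le (P : Params) {q : E3} (hq : ‖q‖ ≤ 1) :
    ‖vmap P.psat q‖ ≤ P.Km * ‖q‖ := by
  have h : ∀ i, |q i| ≤ 1 := fun i => (PiLp.norm_apply_le q i).trans hq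
  have hK := P.one_le_Km
  refine le_of_sq_le_sq ?_ (by positivity)
  rw [mul_pow, norm_sq_eq, norm_sq_eq]
  simp only [vmap_apply]
  linarith [P.sq_psat_le (h 0), P.sq_psat_le (h 1), P.sq_psat_le (h 2)]

theorem sq_norm_vmap_tanh_le (x : E3) : ‖vmap Real.tanh x‖ ^ 2 ≤ ‖x‖ ^ 2 := by
  rw [norm_sq_eq, norm_sq_eq]
  simp only [vmap_apply]
  linarith [sq_tanh_le (x 0), sq_tanh_le (x 1), sq_tanh_le (x 2)]

theorem continuous_vmap {f : ℝ → ℝ} (hf : Continuous f) : Continuous (vmap f) := by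
  unfold vmap
  fun_prop

namespace Signals

variable {P : Params} {X : Signals} {H : EReal} {t : ℝ}

/-! ### The kinematic Jacobian and the virtual law -/

theorem inner_qv_mv_Γ (w : E3) :
    inner ℝ (X.qv t) (mv (X.Γ t) w) = X.q₀ t / 2 * inner ℝ (X.qv t) w := by
  simp only [inner_eq, mv, Γ, skew, mulVec, dotProduct, Fin.sum_univ_three]
  simp
  ring

theorem inner_mv_Γ_qv (w : E3) :
    inner ℝ w (mv (X.Γ t) (X.qv t)) = X.q₀ t / 2 * inner ℝ (X.qv t) w := by
  simp only [inner_eq, mv, Γ, skew, mulVec, dotProduct, Fin.sum_univ_three]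
  simp
  ring

/-- Since `w` is orthogonal to `qv × w`, the right-hand side is `(q₀²‖w‖² + ‖qv × w‖²) / 4`. -/
theorem sq_norm_le_sq_norm_mv_Γ (w : E3) :
    X.q₀ t ^ 2 / 4 * ‖w‖ ^ 2 ≤ ‖mv (X.Γ t) w‖ ^ 2 := by
  simp only [norm_sq_eq, mv, Γ, skew, mulVec, dotProduct, Fin.sum_univ_three]
  simp
  nlinarith [sq_nonneg (X.qv t 1 * w 2 - X.qv t 2 * w 1),
    sq_nonneg (X.qv t 2 * w 0 - X.qv t 0 * w 2), sq_nonneg (X.qv t 0 * w 1 - X.qv t 1 * w 0)]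

theorem det_Γ (h : ‖X.qv t‖ ^ 2 + X.q₀ t ^ 2 = 1) : (X.Γ t).det = X.q₀ t / 8 := by
  rw [norm_sq_eq] at h
  rw [det_fin_three]
  simp [Γ, skew]
  linear_combination X.q₀ t / 8 * h

theorem mv_Γ_ωv (h : ‖X.qv t‖ ^ 2 + X.q₀ t ^ 2 = 1) (h0 : X.q₀ t ≠ 0) :
    mv (X.Γ t) (X.ωv P t) = -(|X.q₀ t| * P.Bω / 2) • vmap P.psat (X.qv t) := by
  have hdet : IsUnit (X.Γ t).det := by
    rw [det_Γ h]; exact (div_ne_zero h0 (by norm_num)).isUnit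
  have e : ∀ w, mv (X.Γ t) (mv (X.Γ t)⁻¹ w) = w := by
    intro w
    simp [mv, mulVec_mulVec, mul_nonsing_inv _ hdet]
  rw [ωv, mv_eq, map_smul, ← mv_eq, e]
  congr 1
  rw [Params.Bω]
  field_simp

theorem norm_qv_le_one (h : ‖X.qv t‖ ^ 2 + X.q₀ t ^ 2 = 1) : ‖X.qv t‖ ≤ 1 := by
  nlinarith [sq_nonneg (X.q₀ t), norm_nonneg (X.qv t)]

/-- The factor `|q₀|` in the virtual law compensates the blow-up of `Γ⁻¹`, whose norm is at most `2
/ |q₀|`; hence a bound uniform in `q₀`. -/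
theorem norm_ωv_le (h : ‖X.qv t‖ ^ 2 + X.q₀ t ^ 2 = 1) (h0 : X.q₀ t ≠ 0) :
    ‖X.ωv P t‖ ≤ P.Km * P.Bω * ‖X.qv t‖ := by
  have hB := P.Bω_pos
  have hq := abs_pos.2 h0
  have h1 : |X.q₀ t| / 2 * ‖X.ωv P t‖ ≤ ‖mv (X.Γ t) (X.ωv P t)‖ := by
    refine le_of_sq_le_sq ?_ (norm_nonneg _)
    refine le_trans (le_of_eq ?_) (sq_norm_le_sq_norm_mv_Γ _)
    rw [mul_pow, div_pow, sq_abs]; norm_num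
  rw [mv_Γ_ωv h h0, norm_smul, norm_neg, Real.norm_of_nonneg (by positivity)] at h1
  have h2 := norm_vmap_psat_le P (norm_qv_le_one h)
  have h3 : |X.q₀ t| / 2 * ‖X.ωv P t‖ ≤ |X.q₀ t| / 2 * (P.Km * P.Bω * ‖X.qv t‖) := by
    refine h1.trans ?_
    have := mul_le_mul_of_nonneg_left h2 (show 0 ≤ |X.q₀ t| * P.Bω / 2 by positivity)
    linarith
  exact le_of_mul_le_mul_left h3 (by positivity)

/-! ### Estimates of the individual terms -/

theorem inner_sub_dhat_le {d : E3} (hd : ‖d‖ ≤ P.Dm) :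
    inner ℝ (X.z₂ P t) d - inner ℝ (X.z₂ P t) (X.dhat P t) ≤ P.D₀ := by
  set z := X.z₂ P t with hz
  have h1 : inner ℝ z d ≤ P.Dm * (|z 0| + |z 1| + |z 2|) := by
    have hdi : ∀ i, |d i| ≤ P.Dm := fun i => (PiLp.norm_apply_le d i).trans hd
    have key : ∀ i, z i * d i ≤ P.Dm * |z i| := fun i => by
      calc z i * d i ≤ |z i * d i| := le_abs_self _
        _ = |z i| * |d i| := abs_mul _ _
        _ ≤ |z i| * P.Dm := mul_le_mul_of_nonneg_left (hdi i) (abs_nonneg _)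
        _ = _ := mul_comm _ _
    rw [inner_eq]
    linarith [key 0, key 1, key 2]
  have h2 : inner ℝ z (X.dhat P t) = P.Dm * (z 0 * Real.tanh (z 0 / P.μ 0)
      + z 1 * Real.tanh (z 1 / P.μ 1) + z 2 * Real.tanh (z 2 / P.μ 2)) := by
    rw [inner_eq, dhat]
    simp [hz]
    ring
  have key := fun i => mul_le_mul_of_nonneg_left (abs_sub_mul_tanh_div_le (P.μ_pos i) (z i))
    P.Dm_nonneg
  rw [h2, Params.D₀, Fin.sum_univ_three]
  linarith [key 0, key 1, key 2]

theorem inner_le_half_add (x y : E3) : inner ℝ x y ≤ ‖x‖ ^ 2 / 2 + ‖y‖ ^ 2 / 2 := by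
  have := norm_sub_sq_real x y
  nlinarith [sq_nonneg ‖x - y‖]

theorem neg_inner_le_half_add (x y : E3) : -inner ℝ x y ≤ ‖x‖ ^ 2 / 2 + ‖y‖ ^ 2 / 2 := by
  have := norm_add_sq_real x y
  nlinarith [sq_nonneg ‖x + y‖]

theorem neg_inner_le_weighted {c : ℝ} (hc : 0 < c) (x y : E3) :
    -inner ℝ x y ≤ c / 2 * ‖x‖ ^ 2 + ‖y‖ ^ 2 / (2 * c) := by
  have := norm_add_sq_real (c • x) y
  rw [norm_smul, inner_smul_left, Real.norm_of_nonneg hc.le] at this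
  have h : 0 ≤ (c * ‖x‖) ^ 2 + 2 * (c * inner ℝ x y) + ‖y‖ ^ 2 := by
    have h' := sq_nonneg ‖c • x + y‖
    rw [this] at h'
    simpa using h'
  have e : c / 2 * ‖x‖ ^ 2 + ‖y‖ ^ 2 / (2 * c) + inner ℝ x y
      = ((c * ‖x‖) ^ 2 + 2 * (c * inner ℝ x y) + ‖y‖ ^ 2) / (2 * c) := by
    field_simp
    ring
  have : 0 ≤ c / 2 * ‖x‖ ^ 2 + ‖y‖ ^ 2 / (2 * c) + inner ℝ x y := by rw [e]; positivity
  linarith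

/-- The right-hand side of the compensation system. -/
def dξ (P : Params) (X : Signals) (t : ℝ) : E3 :=
  -(P.p₁ + P.p₂ * ‖X.Δτ P t‖ ^ 2 / ‖X.ξ t‖ ^ 2) • X.ξ t + P.Kτ • vmap Real.tanh (X.Δτ P t)

theorem inner_dξ_le (hdom : X.Δτ P t ≠ 0 → X.ξ t ≠ 0) :
    inner ℝ (X.ξ t) (X.dξ P t) ≤
      -(P.p₁ - P.Kτ / 2) * ‖X.ξ t‖ ^ 2 - (P.p₂ - P.Kτ / 2) * ‖X.Δτ P t‖ ^ 2 := by
  rw [dξ, inner_add_right, inner_smul_right, inner_smul_right, real_inner_self_eq_norm_sq]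
  have h1 : -(P.p₁ + P.p₂ * ‖X.Δτ P t‖ ^ 2 / ‖X.ξ t‖ ^ 2) * ‖X.ξ t‖ ^ 2
      = -P.p₁ * ‖X.ξ t‖ ^ 2 - P.p₂ * ‖X.Δτ P t‖ ^ 2 := by
    by_cases hΔ : X.Δτ P t = 0
    · simp [hΔ]
    · have := norm_ne_zero_iff.2 (hdom hΔ)
      field_simp
      ring
  have h2 := mul_le_mul_of_nonneg_left ((inner_le_half_add (X.ξ t) (vmap Real.tanh (X.Δτ P t))).trans
    (add_le_add_right (div_le_div_of_nonneg_right (sq_norm_vmap_tanh_le (X.Δτ P t))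
      zero_le_two) _)) P.Kτ_pos.le
  rw [h1]
  linarith

/-! ### Right derivatives along solutions -/

theorem hasDerivWithinAt_half_sq {f : ℝ → E3} {f' : E3}
    (hf : HasDerivWithinAt f f' (Ici t) t) :
    HasDerivWithinAt (fun s => ‖f s‖ ^ 2 / 2) (inner ℝ (f t) f') (Ici t) t := by
  have := hf.norm_sq.div_const 2
  simpa using this

/-- The part of the Lyapunov function that does not involve the dynamical layer. -/
def V₁ (X : Signals) (t : ℝ) : ℝ := ‖X.qv t‖ ^ 2 / 2 + ‖X.ξ t‖ ^ 2 / 2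

theorem V_eq : X.V P t = X.V₁ t + inner ℝ (X.z₂ P t) (mv P.J (X.z₂ P t)) / 2 := by
  rw [V, V₁]; ring

/-- The value of the right derivative of `V₁` along a solution. -/
def dV₁ (P : Params) (X : Signals) (t : ℝ) : ℝ :=
  inner ℝ (X.qv t) (mv (X.Γ t) (X.ωe t)) + inner ℝ (X.ξ t) (X.dξ P t)

namespace IsSolution

theorem hasDerivWithinAt_V₁ (h : X.IsSolution P H) (ht : 0 ≤ t) (htH : (t : EReal) < H) :
    HasDerivWithinAt X.V₁ (X.dV₁ P t) (Ici t) t :=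
  (hasDerivWithinAt_half_sq (h.kin_v t ht htH)).add (hasDerivWithinAt_half_sq (h.comp t ht htH))

theorem inner_qv_kin_le (h : X.IsSolution P H) (ht : 0 ≤ t) (htH : (t : EReal) < H)
    (h0 : X.q₀ t ≠ 0) :
    inner ℝ (X.qv t) (mv (X.Γ t) (X.ωe t)) ≤ -(|X.q₀ t| * P.Bω / 2) * ‖X.qv t‖ ^ 2
      + X.q₀ t / 2 * inner ℝ (X.qv t) (X.z₂ P t) := by
  have hu := h.unit t ht htH
  have hB := P.Bω_pos
  have e : X.ωe t = X.ωv P t + X.z₂ P t := by rw [z₂]; abel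
  rw [e, mv_eq, map_add, ← mv_eq, ← mv_eq, inner_add_right, inner_qv_mv_Γ (X.z₂ P t),
    mv_Γ_ωv hu h0, inner_smul_right]
  have := mul_le_mul_of_nonneg_left (sq_norm_le_inner_vmap_psat P (norm_qv_le_one hu))
    (show 0 ≤ |X.q₀ t| * P.Bω / 2 by positivity)
  linarith

theorem hasDerivWithinAt_mv_J_z₂ (h : X.IsSolution P H) (ht : 0 ≤ t) (htH : (t : EReal) < H) :
    HasDerivWithinAt (fun s => mv P.J (X.z₂ P s))
      (X.Ωe P t + X.u P t + X.d t - mv P.J (X.dωv t)) (Ici t) t := by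
  have h2 : HasDerivWithinAt (fun s => mv P.J (X.ωv P s)) (mv P.J (X.dωv t)) (Ici t) t :=
    (toEuclideanCLM (𝕜 := ℝ) P.J).hasFDerivAt.comp_hasDerivWithinAt t (h.deriv_ωv t ht htH)
  refine ((h.dyn t ht htH).sub h2).congr_of_mem (fun s _ => ?_) self_mem_Ici
  simp [z₂, mv_eq]

/-- The dynamics only provide a derivative of `J ωe`; invertibility of `J` transfers it to `z₂`. -/
theorem hasDerivWithinAt_z₂ (h : X.IsSolution P H) (ht : 0 ≤ t) (htH : (t : EReal) < H) :
    ∃ z' : E3, HasDerivWithinAt (X.z₂ P) z' (Ici t) t ∧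
      mv P.J z' = X.Ωe P t + X.u P t + X.d t - mv P.J (X.dωv t) := by
  have hJ := h.hasDerivWithinAt_mv_J_z₂ ht htH
  have hdet : IsUnit P.J.det := P.J_posDef.det_pos.ne'.isUnit
  refine ⟨mv P.J⁻¹ (X.Ωe P t + X.u P t + X.d t - mv P.J (X.dωv t)), ?_, ?_⟩
  · refine ((toEuclideanCLM (𝕜 := ℝ) P.J⁻¹).hasFDerivAt.comp_hasDerivWithinAt t hJ).congr_of_mem
      (fun s _ => ?_) self_mem_Ici
    simp [mv, mulVec_mulVec, nonsing_inv_mul _ hdet]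
  · simp [mv, mulVec_mulVec, mul_nonsing_inv _ hdet]

theorem hasDerivWithinAt_V (h : X.IsSolution P H) (ht : 0 ≤ t) (htH : (t : EReal) < H) :
    HasDerivWithinAt (X.V P) (X.dV₁ P t + inner ℝ (X.z₂ P t)
      (X.Ωe P t + X.u P t + X.d t - mv P.J (X.dωv t))) (Ici t) t := by
  obtain ⟨z', hz', e⟩ := h.hasDerivWithinAt_z₂ ht htH
  have hq := (hz'.inner ℝ (h.hasDerivWithinAt_mv_J_z₂ ht htH)).div_const 2
  refine ((h.hasDerivWithinAt_V₁ ht htH).add hq).congr_of_mem (fun s _ => ?_) self_mem_Ici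
    |>.congr_deriv ?_
  · exact V_eq
  · rw [← e, inner_mv_J_comm P z']; ring

/-- Dissipation while the actuators are on, for a control error of size `‖e‖`. -/
theorem dV_le_of_hold (h : X.IsSolution P H) (ht : 0 ≤ t) (htH : (t : EReal) < H)
    (h0 : X.q₀ t ≠ 0) {b₁ : ℝ} (hb₁ : 0 < b₁) (hC₃ : 0 < P.C₃) {e : E3}
    (he : X.τe t = X.τ P t - e) :
    X.dV₁ P t + inner ℝ (X.z₂ P t) (X.Ωe P t + X.u P t + X.d t - mv P.J (X.dωv t)) ≤
      -(|X.q₀ t| * P.Bω / 2) * ‖X.qv t‖ ^ 2 - P.C₁ b₁ * ‖X.z₂ P t‖ ^ 2 - P.C₂ * ‖X.ξ t‖ ^ 2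
        + P.D₀ + ‖e‖ ^ 2 / (2 * b₁) := by
  -- With `u = τ - e - Δτ` the terms `Ωe` and `J dωv` cancel. The remaining `-Γ qv`, tested against
  -- `z₂`, cancels the cross term of `inner_qv_kin_le`, and Young's inequality for `ξ`, `e`, `Δτ`
  -- costs `Ku/2`, `b₁/2`, `1/2` in the coefficient of `‖z₂‖²`.
  have hu : X.Ωe P t + X.u P t + X.d t - mv P.J (X.dωv t)
      = -(P.Kω • X.z₂ P t) - X.dhat P t + X.d t - P.Ku • X.ξ t - mv (X.Γ t) (X.qv t)
        - e - X.Δτ P t := by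
    have : X.u P t = X.τ P t - e - X.Δτ P t := by rw [← he, Δτ]; abel
    rw [this, τ]; abel
  rw [hu]
  simp only [inner_add_right, inner_sub_right, inner_neg_right, inner_smul_right,
    real_inner_self_eq_norm_sq, inner_mv_Γ_qv]
  have h1 := h.inner_qv_kin_le ht htH h0
  have h2 := inner_dξ_le (h.comp_dom t ht htH)
  have h3 := inner_sub_dhat_le (X := X) (t := t) (h.dist t ht htH)
  have h4 := mul_le_mul_of_nonneg_left (neg_inner_le_half_add (X.z₂ P t) (X.ξ t)) P.Ku_pos.le
  have h5 := neg_inner_le_weighted hb₁ (X.z₂ P t) e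
  have h6 := neg_inner_le_half_add (X.z₂ P t) (X.Δτ P t)
  have h7 : 0 ≤ P.C₃ * ‖X.Δτ P t‖ ^ 2 := by positivity
  rw [Params.C₃] at h7
  rw [dV₁, Params.C₁, Params.C₂]
  linarith

/-- Valid in both phases, because `z₂` enters only through its norm and its own dynamics play no
role. -/
theorem dV₁_le (h : X.IsSolution P H) (ht : 0 ≤ t) (htH : (t : EReal) < H)
    (h0 : X.q₀ t ≠ 0) (hC₃ : 0 < P.C₃) :
    X.dV₁ P t ≤ -(|X.q₀ t| / 2) * (P.Bω * ‖X.qv t‖ ^ 2 - ‖X.qv t‖ * ‖X.z₂ P t‖)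
      - P.C₂ * ‖X.ξ t‖ ^ 2 := by
  have h1 := h.inner_qv_kin_le ht htH h0
  have h2 := inner_dξ_le (h.comp_dom t ht htH)
  have h7 : 0 ≤ (P.p₂ - P.Kτ / 2) * ‖X.Δτ P t‖ ^ 2 := by
    rw [Params.C₃] at hC₃
    exact mul_nonneg (by linarith) (sq_nonneg _)
  have h8 : X.q₀ t / 2 * inner ℝ (X.qv t) (X.z₂ P t)
      ≤ |X.q₀ t| / 2 * (‖X.qv t‖ * ‖X.z₂ P t‖) := by
    refine (le_abs_self _).trans ?_
    rw [abs_mul, abs_div, abs_two]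
    exact mul_le_mul_of_nonneg_left (abs_real_inner_le_norm _ _) (by positivity)
  have h9 : 0 ≤ P.Ku / 2 * ‖X.ξ t‖ ^ 2 := by have := P.Ku_pos; positivity
  rw [dV₁, Params.C₂]
  linarith

theorem inner_dξ_le_neg (h : X.IsSolution P H) (ht : 0 ≤ t) (htH : (t : EReal) < H)
    (hC₃ : 0 < P.C₃) : inner ℝ (X.ξ t) (X.dξ P t) ≤ -P.C₂ * ‖X.ξ t‖ ^ 2 := by
  have h2 := inner_dξ_le (h.comp_dom t ht htH)
  have h7 : 0 ≤ (P.p₂ - P.Kτ / 2) * ‖X.Δτ P t‖ ^ 2 := by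
    rw [Params.C₃] at hC₃
    exact mul_nonneg (by linarith) (sq_nonneg _)
  have h9 : 0 ≤ P.Ku / 2 * ‖X.ξ t‖ ^ 2 := by have := P.Ku_pos; positivity
  rw [Params.C₂]
  linarith

/-! ### Continuity -/

/-- Right derivatives give right continuity only, whereas the barrier lemma needs continuity of `V`.
It comes from the formula for `ωv`, in which `Γ` is invertible as `q₀ ≠ 0`. -/
theorem continuousOn_ωv (h : X.IsSolution P H)
    (h0 : ∀ t : ℝ, 0 ≤ t → (t : EReal) < H → X.q₀ t ≠ 0) :
    ContinuousOn (X.ωv P) {t : ℝ | 0 ≤ t ∧ (t : EReal) < H} := by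
  have hqv := h.cont_qv
  have hq₀ := h.cont_q₀
  have hΓ : ContinuousOn X.Γ {t : ℝ | 0 ≤ t ∧ (t : EReal) < H} := by
    have hskew : Continuous skew := by
      unfold skew
      refine continuous_matrix fun i j => ?_
      fin_cases i <;> fin_cases j <;> simp <;> fun_prop
    have := hskew.comp_continuousOn hqv
    unfold Γ
    simp only [Function.comp_def] at this
    fun_prop
  have hinv : ContinuousOn (fun t => (X.Γ t)⁻¹) {t : ℝ | 0 ≤ t ∧ (t : EReal) < H} := by
    intro t ht
    have hdet : (X.Γ t).det ≠ 0 := by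
      rw [det_Γ (h.unit t ht.1 ht.2)]
      exact div_ne_zero (h0 t ht.1 ht.2) (by norm_num)
    refine ContinuousAt.comp_continuousWithinAt (g := fun A => A⁻¹) ?_ (hΓ t ht)
    refine continuousAt_matrix_inv _ ?_
    rw [Ring.inverse_eq_inv']
    exact continuousAt_inv₀ hdet
  have hv := (continuous_vmap P.continuous_psat).comp_continuousOn hqv
  have hv' : ContinuousOn (fun t => (vmap P.psat (X.qv t)).ofLp)
      {t : ℝ | 0 ≤ t ∧ (t : EReal) < H} :=
    (PiLp.continuous_ofLp 2 _).comp_continuousOn hv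
  have hm : ContinuousOn (fun t => (X.Γ t)⁻¹ *ᵥ (vmap P.psat (X.qv t)).ofLp)
      {t : ℝ | 0 ≤ t ∧ (t : EReal) < H} :=
    (Continuous.matrix_mulVec continuous_fst continuous_snd).comp_continuousOn (hinv.prodMk hv')
  have hmv := (PiLp.continuous_toLp 2 _).comp_continuousOn hm
  exact ContinuousOn.smul (f := fun t => -(|X.q₀ t| * P.Mω / (2 * √3))) (by fun_prop) hmv

theorem continuousOn_V₁ (h : X.IsSolution P H) :
    ContinuousOn X.V₁ {t : ℝ | 0 ≤ t ∧ (t : EReal) < H} := by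
  have hqv := h.cont_qv
  have hξ := h.cont_ξ
  unfold V₁
  fun_prop

theorem continuousOn_V (h : X.IsSolution P H)
    (h0 : ∀ t : ℝ, 0 ≤ t → (t : EReal) < H → X.q₀ t ≠ 0) :
    ContinuousOn (X.V P) {t : ℝ | 0 ≤ t ∧ (t : EReal) < H} := by
  have hz : ContinuousOn (X.z₂ P) {t : ℝ | 0 ≤ t ∧ (t : EReal) < H} :=
    h.cont_ωe.sub (h.continuousOn_ωv h0)
  have hJz := (toEuclideanCLM (𝕜 := ℝ) P.J).continuous.comp_continuousOn hz
  exact (h.continuousOn_V₁.add ((hz.inner hJz).div_const 2)).congr fun s _ => V_eq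

/-! ### Switching phases -/

/-- The trigger constrains the error strictly after the turn-on instant; at that instant the error
is zero. -/
theorem exists_hold_error (h : X.IsSolution P H) (htH : (t : EReal) < H)
    {k : ℕ} (hk : X.OnPhase k t) :
    ∃ e : E3, X.τe t = X.τ P t - e ∧ ‖e‖ ^ 2 ≤ P.offThreshold t := by
  refine ⟨X.eτ P k t, ?_, ?_⟩
  · rw [h.hold k t htH hk, eτ]; abel
  · rcases hk.1.lt_or_eq with hlt | heq
    · exact (h.turnOff k).before t hlt hk.2 htH
    · rw [eτ, heq, EReal.toReal_coe, sub_self]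
      simpa using (P.offThreshold_pos t).le

theorem sq_norm_z₂_le_of_turnOn (h : X.IsSolution P H) (ht : 0 ≤ t) (htH : (t : EReal) < H)
    {s s' : EReal} (hs : X.TurnOn P H s s') (hst : s ≤ t) (hts : (t : EReal) < s') :
    ‖X.z₂ P t‖ ^ 2 ≤ P.onThreshold t := by
  obtain ⟨z', hz', -⟩ := h.hasDerivWithinAt_z₂ ht htH
  have hz : Tendsto (fun s => ‖X.z₂ P s‖ ^ 2) (𝓝[>] t) (𝓝 (‖X.z₂ P t‖ ^ 2)) :=
    ((hz'.continuousWithinAt.mono Ioi_subset_Ici_self).norm.pow 2)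
  have hθ : Tendsto P.onThreshold (𝓝[>] t) (𝓝 (P.onThreshold t)) := by
    have : Continuous P.onThreshold := by unfold Params.onThreshold; fun_prop
    exact this.continuousAt.tendsto.mono_left nhdsWithin_le_nhds
  -- The trigger says nothing at `t = s` itself, so the bound is obtained as a limit from the right.
  refine le_of_tendsto_of_tendsto hz hθ ?_
  have hcoe : Tendsto (fun r : ℝ => (r : EReal)) (𝓝[>] t) (𝓝 (t : EReal)) :=
    continuous_coe_real_ereal.continuousAt.tendsto.mono_left nhdsWithin_le_nhds
  filter_upwards [self_mem_nhdsWithin, hcoe.eventually (gt_mem_nhds hts),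
    hcoe.eventually (gt_mem_nhds htH)] with r hr hrs hrH
  exact hs.before r (hst.trans_lt (EReal.coe_lt_coe_iff.2 hr)) hrs hrH

theorem sq_norm_z₂_le_of_offPhase (h : X.IsSolution P H) (ht : 0 ≤ t) (htH : (t : EReal) < H)
    (hoff : X.OffPhase t) : ‖X.z₂ P t‖ ^ 2 ≤ P.onThreshold t := by
  have ht' : (0 : EReal) ≤ t := by exact_mod_cast ht
  rcases hoff with hlt | ⟨k, h1, h2⟩
  · rcases h.start with h0 | h0
    · rw [h0] at hlt
      exact absurd hlt (not_lt.2 ht')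
    · exact h.sq_norm_z₂_le_of_turnOn ht htH h0 ht' hlt
  · exact h.sq_norm_z₂_le_of_turnOn ht htH (h.turnOn k) h1 h2

/-- At every instant, either `V` dissipates or `‖z₂‖` is below the turn-on threshold. -/
theorem dissipation_or_small (h : X.IsSolution P H) (ht : 0 ≤ t) (htH : (t : EReal) < H)
    (h0 : X.q₀ t ≠ 0) {b₁ : ℝ} (hb₁ : 0 < b₁) (hC₃ : 0 < P.C₃) :
    (∃ v' : ℝ, HasDerivWithinAt (X.V P) v' (Ici t) t ∧
      v' ≤ -(|X.q₀ t| * P.Bω / 2) * ‖X.qv t‖ ^ 2 - P.C₁ b₁ * ‖X.z₂ P t‖ ^ 2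
        - P.C₂ * ‖X.ξ t‖ ^ 2 + P.D₀ + P.offThreshold t / (2 * b₁)) ∨
      ‖X.z₂ P t‖ ^ 2 ≤ P.onThreshold t := by
  rcases h.cover t ht htH with ⟨k, hk⟩ | hoff
  · left
    obtain ⟨e, he, hle⟩ := h.exists_hold_error htH hk
    refine ⟨_, h.hasDerivWithinAt_V ht htH, (h.dV_le_of_hold ht htH h0 hb₁ hC₃ he).trans ?_⟩
    gcongr
  · exact Or.inr (h.sq_norm_z₂_le_of_offPhase ht htH hoff)

end IsSolution

end Signals

/-! ### Bounds and limits of the trigger thresholds -/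

namespace Params

variable (P : Params)

theorem onThreshold_le {t : ℝ} (ht : 0 ≤ t) : P.onThreshold t ≤ P.ρ₀ + P.ρinf := by
  have h1 : Real.exp (-P.γ * t) ≤ 1 := Real.exp_le_one_iff.2 (by nlinarith [P.γ_pos])
  have h2 := Real.exp_pos (-P.γ * t)
  unfold onThreshold
  nlinarith [P.ρ₀_pos, P.ρinf_pos]

theorem offThreshold_le {t : ℝ} (ht : 0 ≤ t) : P.offThreshold t ≤ P.a + P.b := by
  have h1 : Real.exp (-P.β * t) ≤ 1 := Real.exp_le_one_iff.2 (by nlinarith [P.β_pos])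
  unfold offThreshold
  nlinarith [P.a_pos]

theorem tendsto_exp_neg_mul {c : ℝ} (hc : 0 < c) :
    Tendsto (fun t : ℝ => Real.exp (-c * t)) atTop (𝓝 0) :=
  Real.tendsto_exp_atBot.comp (tendsto_id.const_mul_atTop_of_neg (neg_lt_zero.2 hc))

theorem tendsto_onThreshold : Tendsto P.onThreshold atTop (𝓝 P.ρinf) := by
  have h := ((tendsto_exp_neg_mul P.γ_pos).const_mul (P.ρ₀ - P.ρinf)).add_const P.ρinf
  rwa [mul_zero, zero_add] at h

theorem tendsto_offThreshold : Tendsto P.offThreshold atTop (𝓝 P.b) := by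
  have h := ((tendsto_exp_neg_mul P.β_pos).const_mul P.a).add_const P.b
  rwa [mul_zero, zero_add] at h

/-- A common lower bound of the decay rates of the two last parts of `V`. -/
theorem rate_mul_le {b₁ C : ℝ} (hC : 0 ≤ C) (h1 : C ≤ 2 * P.C₁ b₁ / P.lamMax)
    (h2 : C ≤ 2 * P.C₂) (z y : E3) :
    C * (inner ℝ z (mv P.J z) / 2 + ‖y‖ ^ 2 / 2) ≤ P.C₁ b₁ * ‖z‖ ^ 2 + P.C₂ * ‖y‖ ^ 2 := by
  rw [le_div_iff₀ P.lamMax_pos] at h1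
  have e1 := mul_le_mul_of_nonneg_left (P.inner_mv_J_le z) hC
  have e2 := mul_le_mul_of_nonneg_right h1 (sq_nonneg ‖z‖)
  have e3 := mul_le_mul_of_nonneg_right h2 (sq_nonneg ‖y‖)
  linarith

end Params

/-! ### The coarse bound, for `q₀ ≠ 0` only -/

namespace Signals

variable {P : Params} {X : Signals} {H : EReal}

theorem inner_mv_J_nonneg (P : Params) (z : E3) : 0 ≤ inner ℝ z (mv P.J z) :=
  le_trans (mul_nonneg P.lamMin_pos.le (sq_nonneg _)) (P.le_inner_mv_J z)

theorem V₁_nonneg (t : ℝ) : 0 ≤ X.V₁ t := by unfold V₁; positivity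

theorem V₁_le_V (t : ℝ) : X.V₁ t ≤ X.V P t := by
  rw [V_eq]; linarith [inner_mv_J_nonneg P (X.z₂ P t)]

theorem half_sq_norm_ξ_le_V (t : ℝ) : ‖X.ξ t‖ ^ 2 / 2 ≤ X.V P t :=
  le_trans (by unfold V₁; linarith [sq_nonneg ‖X.qv t‖]) (V₁_le_V t)

theorem half_sq_norm_qv_le_V (t : ℝ) : ‖X.qv t‖ ^ 2 / 2 ≤ X.V P t :=
  le_trans (by unfold V₁; linarith [sq_nonneg ‖X.ξ t‖]) (V₁_le_V t)

theorem Icc_subset_dom {a b : ℝ} (ha : 0 ≤ a) (hb : (b : EReal) < H) :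
    Icc a b ⊆ {t : ℝ | 0 ≤ t ∧ (t : EReal) < H} := fun _ ht =>
  ⟨ha.trans ht.1, (EReal.coe_le_coe_iff.2 ht.2).trans_lt hb⟩

namespace IsSolution

/-- As `‖ξ‖²/2` has derivative at most `-C₂‖ξ‖²` in both phases, it falls at rate `C₂ K` above any
level `K > 0`, so the waiting time depends on `r` alone. -/
theorem half_sq_norm_ξ_le (h : X.IsSolution P H) (hC₂ : 0 < P.C₂) (hC₃ : 0 < P.C₃)
    {K b : ℝ} (hK : 0 < K) (hb0 : 0 ≤ b) (hb : (b : EReal) < H) :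
    ‖X.ξ b‖ ^ 2 / 2 ≤ max (‖X.ξ 0‖ ^ 2 / 2 - P.C₂ * K * b) K := by
  have hdom := Icc_subset_dom le_rfl hb
  have key := le_max_of_eventually_decreasing (f := fun t => ‖X.ξ t‖ ^ 2 / 2) (K := K)
    (c := P.C₂ * K) hb0 (by positivity)
    (by have := h.cont_ξ.mono hdom; fun_prop) ?_
  · simpa using key
  intro t ht hlt
  have htd := hdom (Ico_subset_Icc_self ht)
  refine eventually_le_of_hasDerivWithinAt_lt (hasDerivWithinAt_half_sq (h.comp t htd.1 htd.2)) ?_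
  have h1 := h.inner_dξ_le_neg htd.1 htd.2 hC₃
  rw [dξ] at h1
  refine h1.trans_lt ?_
  nlinarith

/-- Coarse decay of `V`, which uses nothing but `‖qv‖ ≤ 1`. -/
theorem V_le_max (h : X.IsSolution P H)
    (h0 : ∀ t : ℝ, 0 ≤ t → (t : EReal) < H → X.q₀ t ≠ 0) {b₁ C y₀ a b : ℝ} (hb₁ : 0 < b₁)
    (hC₃ : 0 < P.C₃) (hC : 0 < C) (h1 : C ≤ 2 * P.C₁ b₁ / P.lamMax) (h2 : C ≤ 2 * P.C₂)
    (ha : 0 ≤ a) (hab : a ≤ b) (hb : (b : EReal) < H)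
    (hy : ∀ t ∈ Icc a b, ‖X.ξ t‖ ^ 2 / 2 ≤ y₀) :
    X.V P b ≤ max (X.V P a - C / 2 * (b - a))
      (max (1 / 2 + (P.D₀ + (P.a + P.b) / (2 * b₁)) / C + 1)
        (1 / 2 + P.lamMax * (P.ρ₀ + P.ρinf) / 2 + y₀)) := by
  have hdom := Icc_subset_dom ha hb
  refine le_max_of_eventually_decreasing hab (by positivity) ((h.continuousOn_V h0).mono hdom) ?_
  intro t ht hlt
  rw [max_lt_iff] at hlt
  have htd := hdom (Ico_subset_Icc_self ht)
  have hq : ‖X.qv t‖ ^ 2 ≤ 1 := by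
    nlinarith [h.unit t htd.1 htd.2, sq_nonneg (X.q₀ t)]
  have hB := P.Bω_pos
  rcases h.dissipation_or_small htd.1 htd.2 (h0 t htd.1 htd.2) hb₁ hC₃ with ⟨v', hv', hle⟩ | hz
  · refine eventually_le_of_hasDerivWithinAt_lt hv' (hle.trans_lt ?_)
    have e1 := P.rate_mul_le hC.le h1 h2 (X.z₂ P t) (X.ξ t)
    have e2 : 0 ≤ |X.q₀ t| * P.Bω / 2 * ‖X.qv t‖ ^ 2 := by positivity
    have e3 : P.offThreshold t / (2 * b₁) ≤ (P.a + P.b) / (2 * b₁) :=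
      div_le_div_of_nonneg_right (P.offThreshold_le htd.1) (by positivity)
    have e4 := mul_lt_mul_of_pos_left hlt.1 hC
    have e5 : C * (1 / 2 + (P.D₀ + (P.a + P.b) / (2 * b₁)) / C + 1)
        = C / 2 + (P.D₀ + (P.a + P.b) / (2 * b₁)) + C := by
      field_simp
    have e6 := mul_le_mul_of_nonneg_left hq hC.le
    rw [e5, V] at e4
    linarith
  · exfalso
    have e1 := P.inner_mv_J_le (X.z₂ P t)
    have e2 := mul_le_mul_of_nonneg_left (hz.trans (P.onThreshold_le htd.1)) P.lamMax_pos.le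
    have e3 := hy t (Ico_subset_Icc_self ht)
    have e4 := hlt.2
    rw [V] at e4
    linarith

end IsSolution

end Signals

/-- Ultimate boundedness on every set of solutions that avoids `q₀ = 0`. -/
theorem uub_V_of_ne_zero (P : Params) {b₁ : ℝ} (hb₁ : 0 < b₁)
    (hC₁ : 0 < P.C₁ b₁) (hC₂ : 0 < P.C₂) (hC₃ : 0 < P.C₃) :
    ∃ R : ℝ, UUB P (fun q₀ => q₀ ≠ 0) (fun X t => X.V P t) R := by
  set C := min (2 * P.C₁ b₁ / P.lamMax) (2 * P.C₂) with hCdef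
  have hlam := P.lamMax_pos
  have hC : 0 < C := lt_min (by positivity) (by positivity)
  have h1 : C ≤ 2 * P.C₁ b₁ / P.lamMax := min_le_left _ _
  have h2 : C ≤ 2 * P.C₂ := min_le_right _ _
  set K : ℝ → ℝ := fun y => max (1 / 2 + (P.D₀ + (P.a + P.b) / (2 * b₁)) / C + 1)
        (1 / 2 + P.lamMax * (P.ρ₀ + P.ρinf) / 2 + y) with hK
  have hbound : ∀ r : ℝ, ∀ (X : Signals) (H : EReal), X.IsSolution P H →
      (∀ t : ℝ, 0 ≤ t → (t : EReal) < H → X.q₀ t ≠ 0) → X.V P 0 ≤ r →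
      ∀ t : ℝ, 0 ≤ t → (t : EReal) < H → X.V P t ≤ max r (K (max r 1)) := by
    intro r X H h h0 hr t ht htH
    have hy : ∀ s ∈ Icc 0 t, ‖X.ξ s‖ ^ 2 / 2 ≤ max r 1 := by
      intro s hs
      have hsd := Signals.Icc_subset_dom le_rfl htH hs
      refine (h.half_sq_norm_ξ_le hC₂ hC₃ one_pos hsd.1 hsd.2).trans (max_le_max ?_ le_rfl)
      have := Signals.half_sq_norm_ξ_le_V (P := P) (X := X) 0
      have : 0 ≤ P.C₂ * 1 * s := by have := hsd.1; positivity
      linarith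
    refine (h.V_le_max h0 hb₁ hC₃ hC h1 h2 le_rfl ht htH hy).trans (max_le_max ?_ le_rfl)
    have : 0 ≤ C / 2 * (t - 0) := by rw [sub_zero]; positivity
    linarith
  refine ⟨K 1, fun r => ⟨⟨_, hbound r⟩, fun ε hε => ?_⟩⟩
  set M := max r (K (max r 1)) with hM
  -- The first term is the time for `‖ξ‖²/2` to fall to `1`, the second the time for `V`, then at
  -- most `M`, to fall at rate `C / 2` to `K 1`.
  refine ⟨|r| / P.C₂ + |M| / (C / 2), by positivity, fun X H h h0 hr t ht htH => ?_⟩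
  set T₁ := |r| / P.C₂ with hT₁
  have hT₁0 : 0 ≤ T₁ := by positivity
  have hMC : 0 ≤ |M| / (C / 2) := by positivity
  have hT₁t : T₁ ≤ t := by linarith
  have hT₁H : (T₁ : EReal) < H := (EReal.coe_le_coe_iff.2 hT₁t).trans_lt htH
  have hy : ∀ s ∈ Icc T₁ t, ‖X.ξ s‖ ^ 2 / 2 ≤ 1 := by
    intro s hs
    have hsd := Signals.Icc_subset_dom hT₁0 htH hs
    refine (h.half_sq_norm_ξ_le hC₂ hC₃ one_pos hsd.1 hsd.2).trans (max_le ?_ le_rfl)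
    have e1 := Signals.half_sq_norm_ξ_le_V (P := P) (X := X) 0
    have e2 : P.C₂ * T₁ ≤ P.C₂ * s := mul_le_mul_of_nonneg_left hs.1 hC₂.le
    have e3 : P.C₂ * T₁ = |r| := by rw [hT₁]; field_simp
    linarith [le_abs_self r]
  have key := h.V_le_max h0 hb₁ hC₃ hC h1 h2 hT₁0 hT₁t htH hy
  refine (key.trans (max_le ?_ le_rfl)).trans (by linarith)
  have e1 := hbound r X H h h0 hr T₁ hT₁0 hT₁H
  have e2 : C / 2 * (|M| / (C / 2)) ≤ C / 2 * (t - T₁) :=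
    mul_le_mul_of_nonneg_left (by linarith) (by positivity)
  rw [mul_div_cancel₀ _ (by positivity)] at e2
  have e3 : 0 ≤ K 1 := by
    have := P.ρ₀_pos; have := P.ρinf_pos
    exact le_max_of_le_right (by positivity)
  linarith [le_abs_self M]

/-! ### The refined bound for `q₀` bounded away from zero -/

namespace Params

variable (P : Params)

/-- The level below which the refined analysis brings `V`. -/
def level (δ b₁ : ℝ) : ℝ :=
  max (P.Nk b₁ / P.Ct δ b₁)
    (P.lamMax / P.lamMin * P.ρinf / (2 * P.Bω ^ 2) + P.lamMax * P.ρinf / 2)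

theorem Ct_pos {δ b₁ : ℝ} (hδ : 0 < δ) (hC₁ : 0 < P.C₁ b₁) (hC₂ : 0 < P.C₂) :
    0 < P.Ct δ b₁ := by
  have := P.Bω_pos; have := P.lamMax_pos
  exact lt_min (by positivity) (lt_min (by positivity) (by positivity))

theorem level_le_residualGen (δ b₁ b₂ : ℝ) : P.level δ b₁ ≤ P.residualGen δ b₁ b₂ :=
  max_le_max le_rfl (add_le_add_left (le_max_right _ _) _)

theorem level_le_residual {δ b₁ b₂ : ℝ} (hδ : 0 < δ) (hb₂ : 0 < b₂) (hCd : 0 < P.Cd δ b₂)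
    (hJ : P.lamMax ≤ 4 / δ ^ 2 * P.lamMin) : P.level δ b₁ ≤ P.residual δ b₁ b₂ := by
  refine max_le_max le_rfl (add_le_add_left ?_ _)
  have hB := P.Bω_pos
  have hρ := P.ρinf_pos
  have hle : P.Cd δ b₂ ≤ δ * P.Bω - b₂ := min_le_left _ _
  have h1 : P.lamMax / P.lamMin ≤ 4 / δ ^ 2 := (div_le_iff₀ P.lamMin_pos).2 hJ
  -- `b₂ (δ Bω - b₂)` is largest at `b₂ = δ Bω / 2`; this is where the `4` in the eigenvalue
  -- condition comes from.
  have h2 : b₂ * P.Cd δ b₂ ≤ δ ^ 2 * P.Bω ^ 2 / 4 := by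
    nlinarith [sq_nonneg (δ * P.Bω - 2 * b₂), mul_le_mul_of_nonneg_left hle hb₂.le]
  calc P.lamMax / P.lamMin * P.ρinf / (2 * P.Bω ^ 2)
      ≤ 4 / δ ^ 2 * P.ρinf / (2 * P.Bω ^ 2) := by gcongr
    _ = P.ρinf / (2 * (δ ^ 2 * P.Bω ^ 2 / 4)) := by field_simp
    _ ≤ P.ρinf / (2 * (b₂ * P.Cd δ b₂)) := by gcongr
    _ = P.Nf b₂ / P.Cd δ b₂ := by rw [Nf, div_div, mul_assoc]

theorem level_nonneg (δ b₁ : ℝ) : 0 ≤ P.level δ b₁ := by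
  have := P.Bω_pos; have := P.lamMax_pos; have := P.lamMin_pos; have := P.ρinf_pos
  exact le_max_of_le_right (by positivity)

end Params

namespace Signals.IsSolution

variable {P : Params} {X : Signals} {H : EReal}

/-- Once the transients are smaller than `η`, the maximum of `V` and `V₁ + λ (ρinf + η) / 2`
decreases as long as it exceeds `level + ε`. -/
theorem eventually_max_V_le (h : X.IsSolution P H) {δ b₁ ε η t : ℝ} (hδ : 0 < δ) (hb₁ : 0 < b₁)
    (hC₁ : 0 < P.C₁ b₁) (hC₂ : 0 < P.C₂) (hC₃ : 0 < P.C₃) (hε : 0 < ε)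
    (hηε : η * (P.lamMax / 2 + 1 + P.lamMax / P.lamMin / (2 * P.Bω ^ 2)) ≤ ε / 2)
    (ht : 0 ≤ t) (htH : (t : EReal) < H) (hq : δ ≤ |X.q₀ t|)
    (hξ : ‖X.ξ t‖ ^ 2 / 2 ≤ η) (hon : P.onThreshold t < P.ρinf + η)
    (hoff : P.offThreshold t / (2 * b₁) ≤ P.b / (2 * b₁) + P.Ct δ b₁ * ε / 2)
    (hlt : P.level δ b₁ + ε < max (X.V P t) (X.V₁ t + P.lamMax * (P.ρinf + η) / 2)) :
    ∀ᶠ s in 𝓝[>] t, max (X.V P s) (X.V₁ s + P.lamMax * (P.ρinf + η) / 2) ≤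
      max (X.V P t) (X.V₁ t + P.lamMax * (P.ρinf + η) / 2)
        - min (P.Ct δ b₁ * ε / 4) (δ * P.Bω * ε / 8) * (s - t) := by
  have h0 : X.q₀ t ≠ 0 := abs_pos.1 (hδ.trans_le hq)
  have hB := P.Bω_pos
  have hCt := P.Ct_pos hδ hC₁ hC₂
  have hV := h.hasDerivWithinAt_V ht htH
  have hV₁ := (h.hasDerivWithinAt_V₁ ht htH).add_const (P.lamMax * (P.ρinf + η) / 2)
  have hJle := P.inner_mv_J_le (X.z₂ P t)
  have hleJ := P.le_inner_mv_J (X.z₂ P t)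
  have hmin₁ : min (P.Ct δ b₁ * ε / 4) (δ * P.Bω * ε / 8) ≤ P.Ct δ b₁ * ε / 4 := min_le_left _ _
  have hmin₂ : min (P.Ct δ b₁ * ε / 4) (δ * P.Bω * ε / 8) ≤ δ * P.Bω * ε / 8 := min_le_right _ _
  refine eventually_max_le hV.continuousWithinAt hV₁.continuousWithinAt ?_ ?_
  · intro hle
    rw [max_eq_left hle] at hlt
    rcases h.dissipation_or_small ht htH h0 hb₁ hC₃ with ⟨v', hv', hv⟩ | hz
    · refine eventually_le_of_hasDerivWithinAt_lt hv' (hv.trans_lt ?_)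
      have e1 := P.rate_mul_le hCt.le ((min_le_right _ _).trans (min_le_left _ _))
        ((min_le_right _ _).trans (min_le_right _ _)) (X.z₂ P t) (X.ξ t)
      have e2 : P.Ct δ b₁ ≤ |X.q₀ t| * P.Bω :=
        (min_le_left _ _).trans (mul_le_mul_of_nonneg_right hq hB.le)
      have e3 := mul_le_mul_of_nonneg_right e2 (sq_nonneg ‖X.qv t‖)
      have e4 : P.Nk b₁ / P.Ct δ b₁ + ε < X.V P t :=
        (add_le_add_left (le_max_left _ _) _).trans_lt hlt
      have e5 := mul_lt_mul_of_pos_left e4 hCt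
      rw [mul_add, mul_div_cancel₀ _ hCt.ne', V, Params.Nk] at e5
      have e6 : 0 < P.Ct δ b₁ * ε := by positivity
      linarith
    -- `V₁ + L ≤ V` forces `‖z₂‖² ≥ ρinf + η`, above the turn-on threshold.
    · exfalso
      have e1 := mul_lt_mul_of_pos_left (hz.trans_lt hon) P.lamMax_pos
      rw [V_eq] at hle
      linarith
  · intro hle
    rw [max_eq_right hle] at hlt
    refine eventually_le_of_hasDerivWithinAt_lt hV₁ ((h.dV₁_le ht htH h0 hC₃).trans_lt ?_)
    have e0 : P.lamMax / P.lamMin * P.ρinf / (2 * P.Bω ^ 2) + P.lamMax * P.ρinf / 2 + ε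
        < X.V₁ t + P.lamMax * (P.ρinf + η) / 2 :=
      (add_le_add_left (le_max_right _ _) _).trans_lt hlt
    have hz : ‖X.z₂ P t‖ ^ 2 ≤ P.lamMax / P.lamMin * (P.ρinf + η) := by
      rw [div_mul_eq_mul_div, le_div_iff₀ P.lamMin_pos]
      rw [V_eq] at hle
      linarith
    have e1 : P.lamMax / P.lamMin * (P.ρinf + η) / (2 * P.Bω ^ 2) + ε / 2
        ≤ ‖X.qv t‖ ^ 2 / 2 := by
      rw [V₁] at e0
      have : P.lamMax / P.lamMin * (P.ρinf + η) / (2 * P.Bω ^ 2)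
        = P.lamMax / P.lamMin * P.ρinf / (2 * P.Bω ^ 2)
          + η * (P.lamMax / P.lamMin / (2 * P.Bω ^ 2)) := by ring
      rw [this]
      linarith
    have e2 : ‖X.z₂ P t‖ ^ 2 + P.Bω ^ 2 * ε ≤ P.Bω ^ 2 * ‖X.qv t‖ ^ 2 := by
      have := mul_le_mul_of_nonneg_left e1 (show 0 ≤ 2 * P.Bω ^ 2 by positivity)
      rw [mul_add, mul_div_cancel₀ _ (by positivity)] at this
      linarith
    -- After multiplication by `2 Bω` the right-hand side is `(Bω‖qv‖ - ‖z₂‖)² + Bω²‖qv‖² - ‖z₂‖²`.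
    have e3 : P.Bω * ε / 2 ≤ P.Bω * ‖X.qv t‖ ^ 2 - ‖X.qv t‖ * ‖X.z₂ P t‖ := by
      refine le_of_mul_le_mul_left ?_ (show 0 < 2 * P.Bω by positivity)
      nlinarith [sq_nonneg (P.Bω * ‖X.qv t‖ - ‖X.z₂ P t‖)]
    have e4 : δ / 2 * (P.Bω * ε / 2)
        ≤ |X.q₀ t| / 2 * (P.Bω * ‖X.qv t‖ ^ 2 - ‖X.qv t‖ * ‖X.z₂ P t‖) :=
      mul_le_mul (by linarith) e3 (by positivity) (by positivity)
    have e5 : 0 < δ * P.Bω * ε := by positivity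
    have e6 : 0 ≤ P.C₂ * ‖X.ξ t‖ ^ 2 := by positivity
    linarith

end Signals.IsSolution

theorem uub_V_level (P : Params) {b₁ δ : ℝ} (hb₁ : 0 < b₁)
    (hC₁ : 0 < P.C₁ b₁) (hC₂ : 0 < P.C₂) (hC₃ : 0 < P.C₃) (hδ : 0 < δ) :
    UUB P (fun q₀ => δ ≤ |q₀|) (fun X t => X.V P t) (P.level δ b₁) := by
  have hne : ∀ q : ℝ, δ ≤ |q| → q ≠ 0 := fun q hq => abs_pos.1 (hδ.trans_le hq)
  obtain ⟨R, hR⟩ := uub_V_of_ne_zero P hb₁ hC₁ hC₂ hC₃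
  intro r
  obtain ⟨⟨M, hM⟩, -⟩ := hR r
  refine ⟨⟨M, fun X H h hq hr => hM X H h (fun t ht htH => hne _ (hq t ht htH)) hr⟩,
    fun ε hε => ?_⟩
  have hB := P.Bω_pos
  have hlM := P.lamMax_pos
  have hlm := P.lamMin_pos
  have hρ := P.ρinf_pos
  have hCt := P.Ct_pos hδ hC₁ hC₂
  -- The summands account for the excess `η` in `L`, in the energy of `ξ`, and in the bound of
  -- `‖z₂‖²`; together they may use up half of `ε`.
  set κ := P.lamMax / 2 + 1 + P.lamMax / P.lamMin / (2 * P.Bω ^ 2) with hκ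
  have hκ0 : 0 < κ := by positivity
  set η := ε / 2 / κ with hη
  have hη0 : 0 < η := by positivity
  have hηε : η * κ ≤ ε / 2 := by rw [hη, div_mul_cancel₀ _ hκ0.ne']
  obtain ⟨T₀, hT₀⟩ : ∃ T₀ : ℝ, ∀ t ≥ T₀, P.onThreshold t < P.ρinf + η ∧
      P.offThreshold t / (2 * b₁) ≤ P.b / (2 * b₁) + P.Ct δ b₁ * ε / 2 := by
    refine eventually_atTop.1 ?_
    have e1 := P.tendsto_onThreshold.eventually (gt_mem_nhds (show P.ρinf < P.ρinf + η by linarith))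
    have e2 := (P.tendsto_offThreshold.div_const (2 * b₁)).eventually
      (gt_mem_nhds (show P.b / (2 * b₁) < P.b / (2 * b₁) + P.Ct δ b₁ * ε / 2 by
        linarith [show 0 < P.Ct δ b₁ * ε by positivity]))
    filter_upwards [e1, e2] with t h1 h2 using ⟨h1, h2.le⟩
  -- After `T₁` the thresholds are near their limits and `‖ξ‖²/2 ≤ η`. The coarse bound `M` then
  -- starts the descent of the maximum from at most `|M| + L`, at rate `c`.
  set T₁ := |T₀| + |r| / (P.C₂ * η) with hT₁
  set L := P.lamMax * (P.ρinf + η) / 2 with hL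
  set c := min (P.Ct δ b₁ * ε / 4) (δ * P.Bω * ε / 8) with hc
  have hc0 : 0 < c := lt_min (by positivity) (by positivity)
  have hT₁0 : 0 ≤ T₁ := by positivity
  refine ⟨T₁ + (|M| + L) / c, by positivity, fun X H h hq hr t ht htH => ?_⟩
  have hML : 0 ≤ (|M| + L) / c := by positivity
  have hT₁t : T₁ ≤ t := by linarith
  have h0 : ∀ t : ℝ, 0 ≤ t → (t : EReal) < H → X.q₀ t ≠ 0 := fun t ht htH => hne _ (hq t ht htH)
  have hdom := Signals.Icc_subset_dom hT₁0 htH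
  have key := le_max_of_eventually_decreasing (f := fun s => max (X.V P s) (X.V₁ s + L))
    (K := P.level δ b₁ + ε) hT₁t hc0.le
    (((h.continuousOn_V h0).mono hdom).sup ((h.continuousOn_V₁.mono hdom).add continuousOn_const))
    (fun s hs hlt => by
      have hsd := hdom (Ico_subset_Icc_self hs)
      have hsT : T₀ ≤ s := by
        have : 0 ≤ |r| / (P.C₂ * η) := by positivity
        linarith [le_abs_self T₀, hs.1]
      refine h.eventually_max_V_le hδ hb₁ hC₁ hC₂ hC₃ hε hηε hsd.1 hsd.2 (hq s hsd.1 hsd.2) ?_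
        (hT₀ s hsT).1 (hT₀ s hsT).2 hlt
      refine (h.half_sq_norm_ξ_le hC₂ hC₃ hη0 hsd.1 hsd.2).trans (max_le ?_ le_rfl)
      have e1 := Signals.half_sq_norm_ξ_le_V (P := P) (X := X) 0
      have e2 : P.C₂ * η * (|r| / (P.C₂ * η)) ≤ P.C₂ * η * s :=
        mul_le_mul_of_nonneg_left (by linarith [abs_nonneg T₀, hs.1]) (by positivity)
      rw [mul_div_cancel₀ _ (by positivity)] at e2
      linarith [le_abs_self r])
  refine (le_max_left _ _).trans (key.trans (max_le ?_ le_rfl))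
  have hT₁H := (hdom (left_mem_Icc.2 hT₁t)).2
  have e1 := hM X H h h0 hr T₁ hT₁0 hT₁H
  have e2 : c * ((|M| + L) / c) ≤ c * (t - T₁) :=
    mul_le_mul_of_nonneg_left (by linarith) hc0.le
  rw [mul_div_cancel₀ _ hc0.ne'] at e2
  have e3 : max (X.V P T₁) (X.V₁ T₁ + L) ≤ |M| + L := by
    have hL0 : 0 ≤ L := by positivity
    have := Signals.V₁_le_V (P := P) (X := X) T₁
    exact max_le (by linarith [le_abs_self M]) (by linarith [le_abs_self M])
  linarith [P.level_nonneg δ b₁]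

/-! ### Consequences -/

theorem UUB.mono {P : Params} {c : ℝ → Prop} {f : Signals → ℝ → ℝ} {R R' : ℝ}
    (h : UUB P c f R) (hR : R ≤ R') : UUB P c f R' := fun r =>
  ⟨(h r).1, fun ε hε => (h r).2 ε hε |>.imp fun _ hT =>
    ⟨hT.1, fun X H hX hc hr t ht htH => (hT.2 X H hX hc hr t ht htH).trans (by linarith)⟩⟩

/-- A quantity dominated by a continuous monotone function of a uniformly ultimately bounded
quantity is uniformly ultimately bounded. -/
theorem UUB.comp {P : Params} {c : ℝ → Prop} {f g : Signals → ℝ → ℝ} {R : ℝ} {φ : ℝ → ℝ}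
    (h : UUB P c f R) (hφ : Monotone φ) (hφc : Continuous φ)
    (hg : ∀ (X : Signals) (H : EReal), X.IsSolution P H →
      ∀ t : ℝ, 0 ≤ t → (t : EReal) < H → c (X.q₀ t) → g X t ≤ φ (f X t)) :
    UUB P c g (φ R) := by
  intro r
  obtain ⟨⟨M, hM⟩, hT⟩ := h r
  refine ⟨⟨φ M, fun X H hX hc hr t ht htH =>
    (hg X H hX t ht htH (hc t ht htH)).trans (hφ (hM X H hX hc hr t ht htH))⟩, fun ε hε => ?_⟩
  obtain ⟨ε', hε', hle⟩ : ∃ ε' > 0, φ (R + ε') < φ R + ε := by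
    have h1 : Tendsto (fun e => φ (R + e)) (𝓝[>] 0) (𝓝 (φ R)) :=
      (Continuous.tendsto' (by fun_prop) 0 _ (by simp)).mono_left nhdsWithin_le_nhds
    obtain ⟨e, he, he'⟩ := ((h1.eventually (gt_mem_nhds (show φ R < φ R + ε by linarith))).and
      self_mem_nhdsWithin).exists
    exact ⟨e, he', he⟩
  obtain ⟨T, hT0, hT⟩ := hT ε' hε'
  exact ⟨T, hT0, fun X H hX hc hr t ht htH =>
    ((hg X H hX t (hT0.trans ht) htH (hc t (hT0.trans ht) htH)).trans
      (hφ (hT X H hX hc hr t ht htH))).trans hle.le⟩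

namespace Signals

variable {P : Params} {X : Signals} {H : EReal} {t : ℝ}

theorem norm_qv_le_sqrt_V : ‖X.qv t‖ ≤ √(2 * X.V P t) :=
  Real.le_sqrt_of_sq_le (by linarith [half_sq_norm_qv_le_V (P := P) (X := X) t])

theorem norm_z₂_le_sqrt_V : ‖X.z₂ P t‖ ≤ √(2 * X.V P t / P.lamMin) := by
  refine Real.le_sqrt_of_sq_le ?_
  rw [le_div_iff₀ P.lamMin_pos, V_eq]
  linarith [P.le_inner_mv_J (X.z₂ P t), V₁_nonneg (X := X) t]

theorem IsSolution.norm_ωe_le_sqrt_V (h : X.IsSolution P H) (ht : 0 ≤ t) (htH : (t : EReal) < H)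
    (h0 : X.q₀ t ≠ 0) :
    ‖X.ωe t‖ ≤ √(2 * X.V P t / P.lamMin) + P.Km * P.Bω * √(2 * X.V P t) := by
  have e : X.ωe t = X.z₂ P t + X.ωv P t := by rw [z₂]; abel
  have hK := P.one_le_Km
  have hB := P.Bω_pos
  rw [e]
  refine (norm_add_le _ _).trans (add_le_add norm_z₂_le_sqrt_V
    ((norm_ωv_le (h.unit t ht htH) h0).trans ?_))
  exact mul_le_mul_of_nonneg_left norm_qv_le_sqrt_V (by positivity)

end Signals

end AttitudeETC

end

theorem theorem1 (P : AttitudeETC.Params) (b₁ : ℝ) (hb₁ : 0 < b₁)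
    (hC₁ : 0 < P.C₁ b₁) (hC₂ : 0 < P.C₂) (hC₃ : 0 < P.C₃) :
    (∃ R : ℝ, AttitudeETC.UUB P (fun q₀ => q₀ ≠ 0) (fun X t => X.V P t) R) ∧
    ∀ δ : ℝ, 0 < δ → ∀ b₂ : ℝ, 0 < b₂ → 0 < P.Cd δ b₂ →
      (P.lamMax ≤ 4 / δ ^ 2 * P.lamMin →
        AttitudeETC.UUB P (fun q₀ => δ ≤ |q₀|) (fun X t => X.V P t) (P.residual δ b₁ b₂)) ∧
      AttitudeETC.UUB P (fun q₀ => δ ≤ |q₀|) (fun X t => X.V P t) (P.residualGen δ b₁ b₂) ∧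
      AttitudeETC.UUB P (fun q₀ => δ ≤ |q₀|) (fun X t => ‖X.qv t‖)
        √(2 * P.residualGen δ b₁ b₂) ∧
      AttitudeETC.UUB P (fun q₀ => δ ≤ |q₀|) (fun X t => ‖X.ωe t‖)
        (√(2 * P.residualGen δ b₁ b₂ / P.lamMin)
          + P.Km * P.Bω * √(2 * P.residualGen δ b₁ b₂)) := by
  refine ⟨AttitudeETC.uub_V_of_ne_zero P hb₁ hC₁ hC₂ hC₃, fun δ hδ b₂ hb₂ hCd => ?_⟩
  have hlevel := AttitudeETC.uub_V_level P hb₁ hC₁ hC₂ hC₃ hδ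
  have hgen := hlevel.mono (P.level_le_residualGen δ b₁ b₂)
  have hK := P.one_le_Km
  have hB := P.Bω_pos
  have hlm := P.lamMin_pos
  refine ⟨fun hJ => hlevel.mono (P.level_le_residual hδ hb₂ hCd hJ), hgen, ?_, ?_⟩
  · refine hgen.comp (φ := fun v => √(2 * v)) (fun v w hvw => ?_) (by fun_prop) ?_
    · exact Real.sqrt_le_sqrt (by linarith)
    · exact fun X H _ t _ _ _ => AttitudeETC.Signals.norm_qv_le_sqrt_V
  · refine hgen.comp (φ := fun v => √(2 * v / P.lamMin) + P.Km * P.Bω * √(2 * v))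
      (fun v w hvw => ?_) (by fun_prop) ?_
    · dsimp only
      gcongr
    · exact fun X H hX t ht htH hq =>
        hX.norm_ωe_le_sqrt_V ht htH (abs_pos.1 (hδ.trans_le hq))
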